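/- Let $b>0$, $p\in(0,1)$, $q=1-p$. Let $X=(X(t))_{t\ge 0}$, $X(0)=1$ a.s., be the birth–death type Markov branching process with death rate $pb$ and birth (binary splitting) rate $qb$: a time-homogeneous continuous-time Markov chain on $\mathbb{Z}_+$ with almost surely right-continuous paths having left limits, and with an honest transition function whose $Q$-matrix is $q_{i,i-1}=ipb$, $q_{i,i}=-ib$, $q_{i,i+1}=iqb$ for $i\ge 1$ and $q_{ij}=0$ otherwise. Let $Y(t)$ be its death number until time $t$, that is, the number of $s\in(0,t]$ with $X(s-)=X(s)+1$. Then, for all $t\ge 0$, $Y(t)$ is an almost surely finite random variable (up to modification on a null set), and: (i) For every $v\in[0,1]$, the function $t\mapsto G(t,1,v):=E[v^{Y(t)}]$ is the unique solution on $[0,\infty)$ of the Riccati equation $$y'=b\,(pv-y+qy^2),\qquad y(0)=1 .$$ For every $t\ge0$ and every $v\in[0,1)$, and also for $v=1$ if $p<q$, $$G(t,1,v)=\beta(v)+\frac{\alpha(v)-\beta(v)}{1+\frac{\alpha(v)-1}{1-\beta(v)}\,e^{(\alpha(v)-\beta(v))bqt}},\qquad \alpha(v)=\frac{1+\sqrt{1-4pqv}}{2q},\quad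 \beta(v)=\frac{1-\sqrt{1-4pqv}}{2q}.$$ (ii) The probabilities $g_n(t)=P(Y(t)=n)$, $t\ge 0$, satisfy $$g_0(t)=\frac{1}{q+p\,e^{bt}},\qquad g_n(t)=\frac{e^{bt}}{(q+p\,e^{bt})^2}\int_0^t (q+p\,e^{bs})^2e^{-bs}F_n(s)\,ds\quad(n\ge 1),$$ where the integrand is integrable on $[0,t]$ and $$F_n(t)=bp\,\delta_{1,n}+bq\sum_{k=1}^{n-1}g_k(t)\,g_{n-k}(t).$$ -/

import Mathlib

open MeasureTheory Filter Topology Set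

/-- An honest transition function `P t i j` (`t ≥ 0`) on the countable state space `ℕ`. -/
structure IsTransitionFunction (P : ℝ → ℕ → ℕ → ℝ) : Prop where
  nonneg : ∀ t, 0 ≤ t → ∀ i j, 0 ≤ P t i j
  hasSum_one : ∀ t, 0 ≤ t → ∀ i, HasSum (fun j => P t i j) 1
  zero : ∀ i j, P 0 i j = if i = j then 1 else 0
  chapman_kolmogorov : ∀ s t, 0 ≤ s → 0 ≤ t → ∀ i j,
    HasSum (fun k => P s i k * P t k j) (P (s + t) i j)

/-- `Q` is the `Q`-matrix (infinitesimal generator) of `P`: the right derivative of `P` at time `0`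
exists entrywise and is `Q`. -/
def HasQMatrix (P : ℝ → ℕ → ℕ → ℝ) (Q : ℕ → ℕ → ℝ) : Prop :=
  ∀ i j, HasDerivWithinAt (fun t => P t i j) (Q i j) (Ici 0) 0

/-- The branching `Q`-matrix with rates `r`: `q i j = i * r (j - i + 1)` if `i ≥ 1` and
`j ≥ i - 1`, and `q i j = 0` otherwise. Here `r k` (`k ≠ 1`) is the rate at which a particle is
replaced by `k` particles, and `r 1 = -∑ k ≠ 1, r k`. -/
noncomputable def branchingQMatrix (r : ℕ → ℝ) (i j : ℕ) : ℝ :=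
  if 1 ≤ i ∧ i ≤ j + 1 then (i : ℝ) * r (j + 1 - i) else 0

/-- The rates of the birth-death type branching process in which a particle dies at rate `p * b`
and splits in two at rate `q * b`, where `p + q = 1`. -/
noncomputable def birthDeathRates (b p q : ℝ) : ℕ → ℝ
  | 0 => p * b
  | 1 => -b
  | 2 => q * b
  | _ => 0

/-- `X` (observed at times `t ≥ 0`) is a time-homogeneous Markov chain with transition function `P`:
its finite-dimensional distributions are the ones that `P` prescribes. -/
structure IsMarkovChain {Ω : Type*} [MeasurableSpace Ω] (μ : Measure Ω) (X : ℝ → Ω → ℕ)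
    (P : ℝ → ℕ → ℕ → ℝ) : Prop where
  measurable : ∀ t, 0 ≤ t → Measurable (X t)
  law : ∀ (n : ℕ) (t : ℕ → ℝ) (i : ℕ → ℕ), 0 ≤ t 0 → Monotone t →
    μ.real {ω | ∀ k ≤ n, X (t k) ω = i k} =
      μ.real {ω | X (t 0) ω = i 0} *
        ∏ k ∈ Finset.range n, P (t (k + 1) - t k) (i k) (i (k + 1))

/-- The path `x`, restricted to `[0, ∞)`, is right-continuous with left limits in the discrete
space `ℕ`. -/
def IsCadlagPath (x : ℝ → ℕ) : Prop :=
  (∀ s, 0 ≤ s → ContinuousWithinAt x (Ici s) s) ∧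
    ∀ s, 0 < s → ∃ k : ℕ, Tendsto x (𝓝[<] s) (𝓝 k)

/-- `X` is a Markov branching process with rates `r` on `(Ω, μ)`: a Markov chain whose honest
transition function has the branching `Q`-matrix, with almost all paths càdlàg. -/
def IsMarkovBranchingProcess {Ω : Type*} [MeasurableSpace Ω] (μ : Measure Ω) (r : ℕ → ℝ)
    (X : ℝ → Ω → ℕ) : Prop :=
  (∃ P, IsTransitionFunction P ∧ HasQMatrix P (branchingQMatrix r) ∧ IsMarkovChain μ X P) ∧
    ∀ᵐ ω ∂μ, IsCadlagPath (fun s => X s ω)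

/-- The times in `(0, t]` at which the path `x` jumps down by one: `x (s-) = x s + 1`. -/
def deathTimes (x : ℝ → ℕ) (t : ℝ) : Set ℝ :=
  {s | 0 < s ∧ s ≤ t ∧ Tendsto x (𝓝[<] s) (𝓝 (x s + 1))}

/-- The death number (down crossing number) of `X` until time `t`. -/
noncomputable def deathNumber {Ω : Type*} (X : ℝ → Ω → ℕ) (t : ℝ) (ω : Ω) : ℕ :=
  (deathTimes (fun s => X s ω) t).ncard

/-- The probability generating function `E[v ^ Y(t)]` of the death number `Y(t)`. -/
noncomputable def deathPGF {Ω : Type*} [MeasurableSpace Ω] (μ : Measure Ω) (X : ℝ → Ω → ℕ)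
    (t v : ℝ) : ℝ :=
  ∫ ω, v ^ deathNumber X t ω ∂μ

/-- The probability `g n t` that the death number until time `t` equals `n`. -/
noncomputable def deathProb {Ω : Type*} [MeasurableSpace Ω] (μ : Measure Ω) (X : ℝ → Ω → ℕ)
    (n : ℕ) (t : ℝ) : ℝ :=
  μ.real {ω | deathNumber X t ω = n}

/-- The larger root of `q * y ^ 2 - y + p * v`. -/
noncomputable def rootAlpha (p q v : ℝ) : ℝ := (1 + √(1 - 4 * p * q * v)) / (2 * q)

/-- The smaller root of `q * y ^ 2 - y + p * v`. -/
noncomputable def rootBeta (p q v : ℝ) : ℝ := (1 - √(1 - 4 * p * q * v)) / (2 * q)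

/-- The inhomogeneity `F n t = b p δ_{1,n} + b q ∑_{k=1}^{n-1} g k t * g (n-k) t`. -/
noncomputable def recursionTerm (b p q : ℝ) (g : ℕ → ℝ → ℝ) (n : ℕ) (t : ℝ) : ℝ :=
  b * p * (if n = 1 then 1 else 0) + b * q * ∑ k ∈ Finset.Ico 1 n, g k t * g (n - k) t

/-! The generating function is computed by discretising time, using only the `Q`-matrix and the path
regularity; neither the Kolmogorov equations nor the branching property of `P` is needed. By
compactness a càdlàg path has finitely many jumps on `[0, t]`, and on a fine grid the deaths are
exactly the steps on which the sampled path drops by one (`IsCadlagPath.deathTimes_eq_sampled`).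
Hence `E[v ^ Y(t)]` is the limit of `sampledWeight`, an `N`-fold iterate of a weighted one-step
operator.

Let `y` solve the Riccati equation. The generator with deaths weighted by `v`, applied to `j ↦ y ^
j`, gives `i y^(i-1) b (p v - y + q y^2)`, the time derivative of `y ^ i`. So one step of length `h`
sends `y(s) ^ j` to `y(s + h) ^ i` up to `o(h)`, uniformly in `s` and in `i ≤ K`
(`IsRiccatiSolution.eventually_one_step`). Summed over the grid, the errors are small as long as the
chain stays below `K` (`abs_sampledWeight_sub_le`), and the probability of leaving vanishes as `K →
∞` because paths are bounded. This yields `deathPGF_eq_of_isRiccatiSolution`. Explicit solutions and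
local Lipschitz uniqueness give the first half of the theorem.

For the probabilities, the Riccati equation is integrated in time and coefficients of `v ^ n` are
compared (`eq_add_integral_riccatiCoeff`); this avoids assuming any regularity of `g n`. For `n ≥ 1`
the result is a linear equation for `g n` with inhomogeneity built from `g 1, …, g (n-1)`, solved by
an integrating factor (`eq_integral_recursionTerm`). -/

/-! ### Jumps of càdlàg paths and their detection on a grid. -/

theorem deathTimes_zero (x : ℝ → ℕ) : deathTimes x 0 = ∅ := by
  ext s
  simp only [deathTimes, mem_ofPred_eq, mem_empty_iff_false, iff_false]
  rintro ⟨h1, h2, -⟩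
  linarith

theorem deathTimes_mono (x : ℝ → ℕ) {s t : ℝ} (hst : s ≤ t) : deathTimes x s ⊆ deathTimes x t :=
  fun _ hu => ⟨hu.1, hu.2.1.trans hst, hu.2.2⟩

/-- A càdlàg path is constant on small intervals to the left and to the right of a point. -/
theorem IsCadlagPath.exists_locally_const {x : ℝ → ℕ} (hx : IsCadlagPath x) {c : ℝ} (hc : 0 ≤ c) :
    ∃ ε > 0, ∃ l : ℕ, (∀ s, 0 ≤ s → c - ε < s → s < c → x s = l) ∧
      ∀ s, c ≤ s → s < c + ε → x s = x c := by
  have hr := hx.1 c hc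
  rw [ContinuousWithinAt, nhds_discrete, tendsto_pure, eventually_nhdsWithin_iff,
    Metric.eventually_nhds_iff] at hr
  obtain ⟨ε₁, hε₁, h₁⟩ := hr
  have hright : ∀ s, c ≤ s → s < c + ε₁ → x s = x c := fun s hs hs' =>
    h₁ (by rw [Real.dist_eq, abs_of_nonneg (by linarith)]; linarith) hs
  rcases hc.eq_or_lt with rfl | hc
  -- At `c = 0` the left-hand clause is vacuous, so the value `0` for `l` is a dummy.
  · exact ⟨ε₁, hε₁, 0, fun s hs _ hs' => absurd hs' (not_lt.mpr hs), hright⟩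
  · obtain ⟨l, hl⟩ := hx.2 c hc
    rw [nhds_discrete, tendsto_pure, eventually_nhdsWithin_iff, Metric.eventually_nhds_iff] at hl
    obtain ⟨ε₂, hε₂, h₂⟩ := hl
    refine ⟨min ε₁ ε₂, lt_min hε₁ hε₂, l, fun s _ hs hs' => h₂ ?_ hs', fun s hs hs' =>
      hright s hs (hs'.trans_le (by linarith [min_le_left ε₁ ε₂]))⟩
    rw [Real.dist_eq, abs_of_neg (by linarith)]
    linarith [min_le_right ε₁ ε₂]

theorem IsCadlagPath.exists_le {x : ℝ → ℕ} (hx : IsCadlagPath x) (T : ℝ) :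
    ∃ K : ℕ, ∀ s ∈ Icc 0 T, x s ≤ K := by
  refine isCompact_Icc.induction_on (p := fun S => ∃ K : ℕ, ∀ s ∈ S, x s ≤ K) ⟨0, by simp⟩
    (fun S S' hS ⟨K, hK⟩ => ⟨K, fun s hs => hK s (hS hs)⟩) ?_ ?_
  · rintro S S' ⟨K, hK⟩ ⟨K', hK'⟩
    refine ⟨max K K', fun s hs => hs.elim (fun h => (hK s h).trans (le_max_left _ _))
      fun h => (hK' s h).trans (le_max_right _ _)⟩
  · intro c hc
    obtain ⟨ε, hε, l, hl, hr⟩ := hx.exists_locally_const hc.1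
    refine ⟨Ioo (c - ε) (c + ε) ∩ Icc 0 T, inter_mem (mem_nhdsWithin_of_mem_nhds
      (Ioo_mem_nhds (by linarith) (by linarith))) self_mem_nhdsWithin, max l (x c), ?_⟩
    rintro s ⟨⟨h1, h2⟩, h3⟩
    rcases lt_or_ge s c with h | h
    · rw [hl s h3.1 h1 h]; exact le_max_left _ _
    · rw [hr s h h2]; exact le_max_right _ _

/-- A point to whose left a path is constant is not a death time. -/
theorem not_tendsto_of_const_left {x : ℝ → ℕ} {a s : ℝ} (has : a < s)
    (h : ∀ u ∈ Ioo a s, x u = x s) : ¬ Tendsto x (𝓝[<] s) (𝓝 (x s + 1)) := by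
  intro ht
  have h' : Tendsto x (𝓝[<] s) (𝓝 (x s)) :=
    tendsto_nhds_of_eventually_eq (eventually_of_mem (Ioo_mem_nhdsLT has) h)
  have := tendsto_nhds_unique ht h'
  omega

/-- On short intervals a càdlàg path has at most one death time, and it is visible from the values
at the end points. -/
theorem IsCadlagPath.exists_mesh {x : ℝ → ℕ} (hx : IsCadlagPath x) (T : ℝ) :
    ∃ δ > 0, ∀ a a', 0 ≤ a → a ≤ a' → a' ≤ T → a' - a < δ →
      ({s | Tendsto x (𝓝[<] s) (𝓝 (x s + 1))} ∩ Ioc a a').Finite ∧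
      ({s | Tendsto x (𝓝[<] s) (𝓝 (x s + 1))} ∩ Ioc a a').ncard =
        if x a = x a' + 1 then 1 else 0 := by
  choose! ε hε l hl hr using fun c (hc : 0 ≤ c) => hx.exists_locally_const hc
  -- Below the Lebesgue number, `[a, a']` lies in one neighbourhood of some `c`, where the path has
  -- one value before `c` and one from `c` on. Only `c` can be a death time.
  obtain ⟨δ, hδ, hcov⟩ := lebesgue_number_lemma_of_metric (s := Icc (0 : ℝ) T)
    (c := fun c : Icc (0 : ℝ) T => Ioo (c.1 - ε c.1) (c.1 + ε c.1)) isCompact_Icc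
    (fun _ => isOpen_Ioo) (fun c hc => mem_iUnion.mpr ⟨⟨c, hc⟩, by
      have := hε c hc.1
      constructor <;> dsimp only <;> linarith⟩)
  refine ⟨δ, hδ, fun a a' ha haa' ha'T hlt => ?_⟩
  obtain ⟨⟨c, hc⟩, hball⟩ := hcov a ⟨ha, haa'.trans ha'T⟩
  have hin : ∀ s ∈ Icc a a', c - ε c < s ∧ s < c + ε c := fun s hs => by
    have : s ∈ Metric.ball a δ := by
      rw [Metric.mem_ball, Real.dist_eq, abs_of_nonneg (by linarith [hs.1])]
      linarith [hs.2]
    exact hball this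
  have hL : ∀ s ∈ Icc a a', s < c → x s = l c := fun s hs h =>
    hl c hc.1 s (ha.trans hs.1) (hin s hs).1 h
  have hR : ∀ s ∈ Icc a a', c ≤ s → x s = x c := fun s hs h => hr c hc.1 s h (hin s hs).2
  have hsub : ({s | Tendsto x (𝓝[<] s) (𝓝 (x s + 1))} ∩ Ioc a a') ⊆ {c} := by
    rintro s ⟨hs, hsa⟩
    by_contra hne
    have hsa' := Ioc_subset_Icc_self hsa
    rcases lt_or_gt_of_ne hne with h | h
    · refine not_tendsto_of_const_left hsa.1 (fun u hu => ?_) hs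
      rw [hL s hsa' h, hL u ⟨hu.1.le, hu.2.le.trans hsa.2⟩ (hu.2.trans h)]
    · refine not_tendsto_of_const_left (max_lt hsa.1 h) (fun u hu => ?_) hs
      rw [hR s hsa' h.le, hR u ⟨(le_max_left _ _).trans hu.1.le, hu.2.le.trans hsa.2⟩
        ((le_max_right _ _).trans hu.1.le)]
  refine ⟨(finite_singleton c).subset hsub, ?_⟩
  by_cases hca : c ∈ Ioc a a'
  · have h1 : x a = l c := hL a ⟨le_rfl, haa'⟩ hca.1
    have h2 : x a' = x c := hR a' ⟨haa', le_rfl⟩ hca.2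
    have htend : Tendsto x (𝓝[<] c) (𝓝 (l c)) :=
      tendsto_nhds_of_eventually_eq (eventually_of_mem (Ioo_mem_nhdsLT hca.1) fun u hu =>
        hL u ⟨hu.1.le, hu.2.le.trans hca.2⟩ hu.2)
    rw [h1, h2]
    split_ifs with hlc
    · rw [ncard_eq_one]
      refine ⟨c, hsub.antisymm ?_⟩
      rintro _ rfl
      exact ⟨by rw [mem_ofPred_eq, ← hlc]; exact htend, hca⟩
    · rw [ncard_eq_zero ((finite_singleton c).subset hsub), eq_empty_iff_forall_notMem]
      intro s hs
      obtain rfl := hsub hs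
      exact hlc (tendsto_nhds_unique htend hs.1)
  · have hxx : x a = x a' := by
      rcases le_or_gt c a with h | h
      · rw [hR a ⟨le_rfl, haa'⟩ h, hR a' ⟨haa', le_rfl⟩ (h.trans haa')]
      · have h' : a' < c := not_le.mp fun h' => hca ⟨h, h'⟩
        rw [hL a ⟨le_rfl, haa'⟩ h, hL a' ⟨haa', le_rfl⟩ h']
    rw [if_neg (by omega), ncard_eq_zero ((finite_singleton c).subset hsub),
      eq_empty_iff_forall_notMem]
    intro s hs
    obtain rfl := hsub hs
    exact hca hs.2

/-- The number of deaths seen when the path `x` is observed at the times `0, h, …, n h`. -/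
def sampledDeaths (x : ℝ → ℕ) (h : ℝ) (n : ℕ) : ℕ :=
  ∑ k ∈ Finset.range n, if x (k * h) = x ((k + 1 : ℕ) * h) + 1 then 1 else 0

/-- Both counts are additive over grid cells, and `exists_mesh` makes them agree on each cell once
`t / N < δ`. -/
theorem IsCadlagPath.deathTimes_eq_sampled {x : ℝ → ℕ} (hx : IsCadlagPath x) {t : ℝ} (ht : 0 ≤ t) :
    (deathTimes x t).Finite ∧
      ∀ᶠ N : ℕ in atTop, (deathTimes x t).ncard = sampledDeaths x (t / N) N := by
  obtain ⟨δ, hδ, hmesh⟩ := hx.exists_mesh t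
  have key : ∀ N : ℕ, 0 < N → t / N < δ → ∀ m ≤ N, (deathTimes x (m * (t / N))).Finite ∧
      (deathTimes x (m * (t / N))).ncard = sampledDeaths x (t / N) m := by
    intro N hN hNδ m
    have hh : 0 ≤ t / N := by positivity
    have hNt : (N : ℝ) * (t / N) = t := by field_simp
    induction m with
    | zero => simp [deathTimes_zero, sampledDeaths]
    | succ m ih =>
      intro hm
      obtain ⟨ih1, ih2⟩ := ih (by omega)
      have hle : (m : ℝ) * (t / N) ≤ ((m + 1 : ℕ) : ℝ) * (t / N) := by
        push_cast; nlinarith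
      obtain ⟨h1, h2⟩ := hmesh (m * (t / N)) ((m + 1 : ℕ) * (t / N)) (by positivity) hle
        (by
          calc ((m + 1 : ℕ) : ℝ) * (t / N) ≤ N * (t / N) := by gcongr
            _ = t := hNt)
        (by push_cast; linarith)
      have hunion : deathTimes x ((m + 1 : ℕ) * (t / N)) = deathTimes x (m * (t / N)) ∪
          ({s | Tendsto x (𝓝[<] s) (𝓝 (x s + 1))} ∩
            Ioc (m * (t / N)) ((m + 1 : ℕ) * (t / N))) := by
        have h0 : 0 ≤ (m : ℝ) * (t / N) := by positivity
        ext s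
        constructor
        · rintro ⟨hs0, hs1, hs2⟩
          rcases le_or_gt s (m * (t / N)) with h | h
          · exact Or.inl ⟨hs0, h, hs2⟩
          · exact Or.inr ⟨hs2, h, hs1⟩
        · rintro (⟨hs0, hs1, hs2⟩ | ⟨hs2, h, hs1⟩)
          · exact ⟨hs0, hs1.trans hle, hs2⟩
          · exact ⟨h0.trans_lt h, hs1, hs2⟩
      have hdisj : Disjoint (deathTimes x (m * (t / N)))
          ({s | Tendsto x (𝓝[<] s) (𝓝 (x s + 1))} ∩
            Ioc (m * (t / N)) ((m + 1 : ℕ) * (t / N))) :=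
        disjoint_left.mpr fun s hs hs' => absurd hs'.2.1 (not_lt.mpr hs.2.1)
      rw [hunion]
      refine ⟨ih1.union h1, ?_⟩
      rw [ncard_union_eq hdisj ih1 h1, ih2, h2, sampledDeaths, sampledDeaths,
        Finset.sum_range_succ]
  have hev : ∀ᶠ N : ℕ in atTop, 0 < N ∧ t / N < δ :=
    (eventually_gt_atTop 0).and
      ((tendsto_const_div_atTop_nhds_zero_nat t).eventually (gt_mem_nhds hδ))
  have hlast : ∀ N : ℕ, 0 < N → (N : ℝ) * (t / N) = t := fun N hN => by field_simp
  constructor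
  · obtain ⟨N, hN, hNδ⟩ := hev.exists
    have := (key N hN hNδ N le_rfl).1
    rwa [hlast N hN] at this
  · filter_upwards [hev] with N hN
    have := (key N hN.1 hN.2 N le_rfl).2
    rwa [hlast N hN.1] at this

/-! ### The chain sampled on a grid. -/

/-- The expectation of `∏ k < m, φ (X (k h)) (X ((k + 1) h))` for the chain `X` with transition
function `P` started at `i`. -/
noncomputable def sampledWeight (P : ℝ → ℕ → ℕ → ℝ) (h : ℝ) (φ : ℕ → ℕ → ℝ) : ℕ → ℕ → ℝ
  | 0, _ => 1
  | m + 1, i => ∑' j, P h i j * (φ i j * sampledWeight P h φ m j)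

theorem IsTransitionFunction.summable_mul {P : ℝ → ℕ → ℕ → ℝ} (hP : IsTransitionFunction P)
    {h : ℝ} (hh : 0 ≤ h) (i : ℕ) {g : ℕ → ℝ} (hg : ∀ j, g j ∈ Icc (0 : ℝ) 1) :
    Summable fun j => P h i j * g j :=
  Summable.of_nonneg_of_le (fun j => mul_nonneg (hP.nonneg h hh i j) (hg j).1)
    (fun j => mul_le_of_le_one_right (hP.nonneg h hh i j) (hg j).2) (hP.hasSum_one h hh i).summable

theorem IsTransitionFunction.tsum_mul_mem_Icc {P : ℝ → ℕ → ℕ → ℝ} (hP : IsTransitionFunction P)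
    {h : ℝ} (hh : 0 ≤ h) (i : ℕ) {g : ℕ → ℝ} (hg : ∀ j, g j ∈ Icc (0 : ℝ) 1) :
    ∑' j, P h i j * g j ∈ Icc (0 : ℝ) 1 := by
  refine ⟨tsum_nonneg fun j => mul_nonneg (hP.nonneg h hh i j) (hg j).1, ?_⟩
  rw [← (hP.hasSum_one h hh i).tsum_eq]
  exact (hP.summable_mul hh i hg).tsum_le_tsum
    (fun j => mul_le_of_le_one_right (hP.nonneg h hh i j) (hg j).2) (hP.hasSum_one h hh i).summable

theorem mul_mem_Icc_zero_one {x y : ℝ} (hx : x ∈ Icc (0 : ℝ) 1) (hy : y ∈ Icc (0 : ℝ) 1) :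
    x * y ∈ Icc (0 : ℝ) 1 :=
  ⟨mul_nonneg hx.1 hy.1, mul_le_one₀ hx.2 hy.1 hy.2⟩

theorem sampledWeight_mem_Icc {P : ℝ → ℕ → ℕ → ℝ} (hP : IsTransitionFunction P) {h : ℝ}
    (hh : 0 ≤ h) {φ : ℕ → ℕ → ℝ} (hφ : ∀ i j, φ i j ∈ Icc (0 : ℝ) 1) (m i : ℕ) :
    sampledWeight P h φ m i ∈ Icc (0 : ℝ) 1 := by
  induction m generalizing i with
  | zero => exact ⟨zero_le_one, le_rfl⟩
  | succ m ih => exact hP.tsum_mul_mem_Icc hh i fun j => mul_mem_Icc_zero_one (hφ i j) (ih j)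

section Chain

variable {Ω : Type*} [MeasurableSpace Ω] {μ : Measure Ω} {X : ℝ → Ω → ℕ} {P : ℝ → ℕ → ℕ → ℝ}

theorem IsMarkovChain.measurable_mul (hX : IsMarkovChain μ X P) {h : ℝ} (hh : 0 ≤ h) (k : ℕ) :
    Measurable (X (k * h)) :=
  hX.measurable _ (by positivity)

variable [IsProbabilityMeasure μ]

theorem IsMarkovChain.measure_cylinder_succ (hX : IsMarkovChain μ X P)
    {h : ℝ} (hh : 0 ≤ h) (m : ℕ) (i : ℕ → ℕ) :
    μ {ω | ∀ k ≤ m + 1, X (k * h) ω = i k} =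
      μ {ω | ∀ k ≤ m, X (k * h) ω = i k} * ENNReal.ofReal (P h (i m) (i (m + 1))) := by
  have hmono : Monotone fun k : ℕ => (k : ℝ) * h := fun a b hab => by dsimp only; gcongr
  have hlaw := fun n => hX.law n (fun k => k * h) i (by simp) hmono
  have hdiff : ∀ k : ℕ, ((k + 1 : ℕ) : ℝ) * h - k * h = h := fun k => by push_cast; ring
  simp only [hdiff] at hlaw
  rw [← ofReal_measureReal, ← ofReal_measureReal, ← ENNReal.ofReal_mul measureReal_nonneg,
    hlaw, hlaw, Finset.prod_range_succ, mul_assoc]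

/-- The Markov property in integrated form. The sampled vector takes countably many values, so both
sides are sums over atoms and no conditional expectation is needed. -/
theorem IsMarkovChain.lintegral_step (hX : IsMarkovChain μ X P)
    {h : ℝ} (hh : 0 ≤ h) (m : ℕ) (G : (Fin (m + 1) → ℕ) → ENNReal) (H : ℕ → ℕ → ENNReal) :
    ∫⁻ ω, G (fun k => X (k * h) ω) * H (X (m * h) ω) (X ((m + 1 : ℕ) * h) ω) ∂μ =
      ∫⁻ ω, G (fun k => X (k * h) ω) *
        ∑' j, ENNReal.ofReal (P h (X (m * h) ω) j) * H (X (m * h) ω) j ∂μ := by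
  have hW : Measurable fun ω => fun k : Fin (m + 1) => X (k * h) ω :=
    measurable_pi_lambda _ fun k => hX.measurable_mul hh k
  have hWX : Measurable fun ω =>
      ((fun k : Fin (m + 1) => X (k * h) ω), X ((m + 1 : ℕ) * h) ω) :=
    hW.prodMk (hX.measurable_mul hh (m + 1))
  have hcyl : ∀ (c : Fin (m + 1) → ℕ) (j : ℕ),
      μ.map (fun ω => ((fun k : Fin (m + 1) => X (k * h) ω), X ((m + 1 : ℕ) * h) ω)) {(c, j)} =
        μ.map (fun ω => fun k : Fin (m + 1) => X (k * h) ω) {c} *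
          ENNReal.ofReal (P h (c (Fin.last m)) j) := by
    intro c j
    rw [Measure.map_apply hWX (measurableSet_singleton _),
      Measure.map_apply hW (measurableSet_singleton _)]
    -- The sequence extends `c` by `j`; its values beyond index `m + 1` are irrelevant.
    have key := hX.measure_cylinder_succ hh m
      (fun k => if hk : k < m + 1 then c ⟨k, hk⟩ else j)
    simp only [lt_add_iff_pos_right, zero_lt_one, dif_pos, lt_self_iff_false, dif_neg,
      not_false_eq_true] at key
    convert key using 3
    · ext ω
      simp only [mem_preimage, mem_singleton_iff, Prod.mk.injEq, mem_ofPred_eq, funext_iff]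
      constructor
      · rintro ⟨h1, h2⟩ k hk
        split_ifs with hkm
        · exact h1 ⟨k, hkm⟩
        · obtain rfl : k = m + 1 := by omega
          exact h2
      · intro hω
        refine ⟨fun k => ?_, ?_⟩
        · have := hω k (by omega)
          rwa [dif_pos k.2] at this
        · have := hω (m + 1) le_rfl
          rwa [dif_neg (lt_irrefl _)] at this
    · ext ω
      simp only [mem_preimage, mem_singleton_iff, mem_ofPred_eq, funext_iff]
      constructor
      · intro h1 k hk
        rw [dif_pos (by omega)]
        exact h1 ⟨k, by omega⟩
      · intro hω k
        have := hω k (by omega)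
        rwa [dif_pos k.2] at this
    · rfl
  calc _ = ∫⁻ z : (Fin (m + 1) → ℕ) × ℕ, G z.1 * H (z.1 (Fin.last m)) z.2
        ∂(μ.map fun ω => ((fun k : Fin (m + 1) => X (k * h) ω), X ((m + 1 : ℕ) * h) ω)) := by
        rw [lintegral_map (measurable_of_countable _) hWX]
        rfl
    _ = ∑' (c : Fin (m + 1) → ℕ) (j : ℕ), G c * H (c (Fin.last m)) j *
        (μ.map (fun ω => fun k : Fin (m + 1) => X (k * h) ω) {c} *
          ENNReal.ofReal (P h (c (Fin.last m)) j)) := by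
        rw [lintegral_countable', ENNReal.tsum_prod']
        simp only [hcyl]
    _ = ∑' c : Fin (m + 1) → ℕ,
        (G c * ∑' j, ENNReal.ofReal (P h (c (Fin.last m)) j) * H (c (Fin.last m)) j) *
          μ.map (fun ω => fun k : Fin (m + 1) => X (k * h) ω) {c} := by
        refine tsum_congr fun c => ?_
        rw [← ENNReal.tsum_mul_left, ← ENNReal.tsum_mul_right]
        exact tsum_congr fun j => by ring
    _ = _ := by
        rw [← lintegral_countable' (fun c : Fin (m + 1) → ℕ =>
          G c * ∑' j, ENNReal.ofReal (P h (c (Fin.last m)) j) * H (c (Fin.last m)) j),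
          lintegral_map (measurable_of_countable _) hW]
        rfl

/-- Averaging over the last sample absorbs its factor into the weight: `(m + 1, l)` becomes `(m, l +
1)`, with `m + l` preserved. -/
theorem IsMarkovChain.lintegral_prod_mul_sampledWeight (hX : IsMarkovChain μ X P)
    (hP : IsTransitionFunction P) {h : ℝ} (hh : 0 ≤ h) {φ : ℕ → ℕ → ℝ}
    (hφ : ∀ i j, φ i j ∈ Icc (0 : ℝ) 1) (m l : ℕ) :
    ∫⁻ ω, (∏ k ∈ Finset.range m, ENNReal.ofReal (φ (X (k * h) ω) (X ((k + 1 : ℕ) * h) ω))) *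
        ENNReal.ofReal (sampledWeight P h φ l (X (m * h) ω)) ∂μ =
      ∫⁻ ω, ENNReal.ofReal (sampledWeight P h φ (m + l) (X 0 ω)) ∂μ := by
  induction m generalizing l with
  | zero => simp
  | succ m ih =>
    have hstep := hX.lintegral_step hh m
      (fun c => ∏ k : Fin m, ENNReal.ofReal (φ (c k.castSucc) (c k.succ)))
      (fun i j => ENNReal.ofReal (φ i j) * ENNReal.ofReal (sampledWeight P h φ l j))
    have hsum : ∀ i, ∑' j, ENNReal.ofReal (P h i j) *
        (ENNReal.ofReal (φ i j) * ENNReal.ofReal (sampledWeight P h φ l j)) =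
        ENNReal.ofReal (sampledWeight P h φ (l + 1) i) := by
      intro i
      have hg : ∀ j, φ i j * sampledWeight P h φ l j ∈ Icc (0 : ℝ) 1 := fun j =>
        mul_mem_Icc_zero_one (hφ i j) (sampledWeight_mem_Icc hP hh hφ l j)
      rw [sampledWeight, ENNReal.ofReal_tsum_of_nonneg
        (fun j => mul_nonneg (hP.nonneg h hh i j) (hg j).1) (hP.summable_mul hh i hg)]
      refine tsum_congr fun j => ?_
      rw [ENNReal.ofReal_mul (hP.nonneg h hh i j), ENNReal.ofReal_mul (hφ i j).1]
    simp only [hsum] at hstep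
    rw [add_assoc, add_comm 1 l, ← ih (l + 1)]
    simp only [Finset.prod_range_succ, Finset.prod_range, mul_assoc] at hstep ⊢
    exact hstep

theorem IsMarkovChain.integral_prod (hX : IsMarkovChain μ X P)
    (hP : IsTransitionFunction P) {i₀ : ℕ} (hX0 : ∀ᵐ ω ∂μ, X 0 ω = i₀) {h : ℝ} (hh : 0 ≤ h)
    {φ : ℕ → ℕ → ℝ} (hφ : ∀ i j, φ i j ∈ Icc (0 : ℝ) 1) (m : ℕ) :
    ∫ ω, ∏ k ∈ Finset.range m, φ (X (k * h) ω) (X ((k + 1 : ℕ) * h) ω) ∂μ =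
      sampledWeight P h φ m i₀ := by
  have hmeas : Measurable fun ω =>
      ∏ k ∈ Finset.range m, φ (X (k * h) ω) (X ((k + 1 : ℕ) * h) ω) :=
    Finset.measurable_prod _ fun k _ =>
      (measurable_of_countable (fun z : ℕ × ℕ => φ z.1 z.2)).comp
        ((hX.measurable_mul hh k).prodMk (hX.measurable_mul hh (k + 1)))
  rw [integral_eq_lintegral_of_nonneg_ae
    (Eventually.of_forall fun ω => Finset.prod_nonneg fun k _ => (hφ _ _).1)
    hmeas.aestronglyMeasurable]
  have := hX.lintegral_prod_mul_sampledWeight hP hh hφ m 0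
  simp only [sampledWeight, ENNReal.ofReal_one, mul_one, add_zero] at this
  simp only [ENNReal.ofReal_prod_of_nonneg fun k _ => (hφ _ _).1]
  rw [this, lintegral_congr_ae (g := fun _ => ENNReal.ofReal (sampledWeight P h φ m i₀))]
  · simp [ENNReal.toReal_ofReal (sampledWeight_mem_Icc hP hh hφ m i₀).1]
  · filter_upwards [hX0] with ω hω
    rw [hω]

end Chain

/-! ### First-order expansion of the semigroup. -/

/-- Row `i` is supported on `i - 1, i, i + 1`. At `i = 0` the truncated `i - 1` is harmless because
of the factor `i`. -/
theorem sum_range_birthDeath (b p q : ℝ) (i : ℕ) (g : ℕ → ℝ) :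
    ∑ j ∈ Finset.range (i + 2), branchingQMatrix (birthDeathRates b p q) i j * g j =
      b * i * (p * g (i - 1) - g i + q * g (i + 1)) := by
  rcases i with _ | n
  · simp [branchingQMatrix]
  · rw [Finset.sum_range_succ, Finset.sum_range_succ, Finset.sum_range_succ, Finset.sum_eq_zero]
    · have h1 : n + 1 + 1 - (n + 1) = 1 := by omega
      have h2 : n + 1 + 1 + 1 - (n + 1) = 2 := by omega
      simp [branchingQMatrix, h1, h2, birthDeathRates]
      ring
    · intro j hj
      rw [Finset.mem_range] at hj
      rw [branchingQMatrix, if_neg (by omega), zero_mul]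

/-- First order expansion of the semigroup on functions with values in `[0, 1]`, uniformly in the
function. -/
theorem HasQMatrix.eventually_abs_tsum_sub_le {P : ℝ → ℕ → ℕ → ℝ} (hP : IsTransitionFunction P)
    {b p q : ℝ} (hpq : p + q = 1)
    (hQ : HasQMatrix P (branchingQMatrix (birthDeathRates b p q))) (i : ℕ) {ε : ℝ} (hε : 0 < ε) :
    ∀ᶠ d in 𝓝[>] (0 : ℝ), ∀ g : ℕ → ℝ, (∀ j, g j ∈ Icc (0 : ℝ) 1) →
      |∑' j, P d i j * g j -
        (g i + d * (b * i * (p * g (i - 1) - g i + q * g (i + 1))))| ≤ ε * d := by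
  set Q := branchingQMatrix (birthDeathRates b p q)
  set S := Finset.range (i + 2)
  have hiS : i ∈ S := Finset.mem_range.mpr (by omega)
  -- The `i + 2` entries in `S` share an error `ε / 2 * d`; the other half is for the tail.
  have hη : 0 < ε / (2 * (i + 2)) := by positivity
  have h1 : ∀ j ∈ S, ∀ᶠ d in 𝓝[>] (0 : ℝ),
      |P d i j - (if i = j then 1 else 0) - d * Q i j| ≤ ε / (2 * (i + 2)) * d := by
    intro j _
    have := (hasDerivWithinAt_iff_isLittleO.mp (hQ i j)).def hη
    filter_upwards [this.filter_mono (nhdsWithin_mono _ Ioi_subset_Ici_self),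
      self_mem_nhdsWithin] with d hd hd0
    simpa [hP.zero, abs_of_pos (show (0 : ℝ) < d from hd0)] using hd
  have h1' := (Filter.eventually_all_finset S).mpr h1
  filter_upwards [h1', self_mem_nhdsWithin] with d hd hd0 g hg
  have hd0 : 0 < d := hd0
  have hsumP := hP.hasSum_one d hd0.le i
  have hsg : Summable fun j => P d i j * g j :=
    Summable.of_nonneg_of_le (fun j => mul_nonneg (hP.nonneg d hd0.le i j) (hg j).1)
      (fun j => mul_le_of_le_one_right (hP.nonneg d hd0.le i j) (hg j).2) hsumP.summable
  have hsplit := hsg.sum_add_tsum_subtype_compl S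
  have hsplitP := hsumP.summable.sum_add_tsum_subtype_compl S
  rw [hsumP.tsum_eq] at hsplitP
  have htail0 : 0 ≤ ∑' j : {j // j ∉ S}, P d i j * g j :=
    tsum_nonneg fun j => mul_nonneg (hP.nonneg d hd0.le i j) (hg j).1
  have htail1 : ∑' j : {j // j ∉ S}, P d i j * g j ≤ ∑' j : {j // j ∉ S}, P d i j :=
    (hsg.subtype _).tsum_le_tsum
      (fun j => mul_le_of_le_one_right (hP.nonneg d hd0.le i j) (hg j).2)
      (hsumP.summable.subtype _)
  have hQ0 : ∑ j ∈ S, Q i j = 0 := by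
    have := sum_range_birthDeath b p q i (fun _ => 1)
    simp only [mul_one] at this
    rw [this, show p - 1 + q = 0 by linarith, mul_zero]
  have hgen := sum_range_birthDeath b p q i g
  have hcard : (S.card : ℝ) * (ε / (2 * (i + 2)) * d) = ε / 2 * d := by
    rw [Finset.card_range]; push_cast; field_simp
  have hone : ∀ f : ℕ → ℝ, (∀ j, f j ∈ Icc (0 : ℝ) 1) →
      |∑ j ∈ S, P d i j * f j - (f i + d * ∑ j ∈ S, Q i j * f j)| ≤ ε / 2 * d := by
    intro f hf
    have : ∑ j ∈ S, P d i j * f j - (f i + d * ∑ j ∈ S, Q i j * f j) =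
        ∑ j ∈ S, (P d i j - (if i = j then 1 else 0) - d * Q i j) * f j := by
      simp only [sub_mul, Finset.sum_sub_distrib, ite_mul, one_mul, zero_mul,
        Finset.sum_ite_eq, hiS, if_true, Finset.mul_sum, mul_assoc]
      ring
    rw [this, ← hcard, ← nsmul_eq_mul]
    refine (Finset.abs_sum_le_sum_abs _ _).trans (Finset.sum_le_card_nsmul _ _ _ fun j hj => ?_)
    rw [abs_mul, abs_of_nonneg (hf j).1]
    exact (mul_le_of_le_one_right (abs_nonneg _) (hf j).2).trans (hd j hj)
  have hA := hone g hg
  -- For the function `1`, honesty of `P` and zero row sums of `Q` turn this into a bound on the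
  -- mass outside `S`. Hence the estimate does not depend on `g`.
  have hB := hone (fun _ => 1) (fun _ => ⟨zero_le_one, le_rfl⟩)
  simp only [mul_one, hQ0, mul_zero, add_zero] at hB
  rw [hgen] at hA
  rw [abs_le] at hA hB ⊢
  constructor <;> linarith

/-! ### The Riccati equation and its closed form. -/

/-- `y` solves the Riccati equation of the death number on `[0, ∞)`, started at `1`. -/
def IsRiccatiSolution (b p q v : ℝ) (y : ℝ → ℝ) : Prop :=
  y 0 = 1 ∧ ∀ t, 0 ≤ t → HasDerivWithinAt y (b * (p * v - y t + q * y t ^ 2)) (Ici 0) t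

theorem IsRiccatiSolution.continuousOn {b p q v : ℝ} {y : ℝ → ℝ}
    (hy : IsRiccatiSolution b p q v y) : ContinuousOn y (Ici 0) :=
  fun t ht => (hy.2 t ht).continuousWithinAt

theorem IsRiccatiSolution.congr {b p q v : ℝ} {y z : ℝ → ℝ}
    (hy : IsRiccatiSolution b p q v y) (h : ∀ t, 0 ≤ t → z t = y t) :
    IsRiccatiSolution b p q v z := by
  refine ⟨(h 0 le_rfl).trans hy.1, fun t ht => ?_⟩
  rw [h t ht]
  exact (hy.2 t ht).congr (fun s hs => h s hs) (h t ht)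

/-- The right-hand side is only locally Lipschitz, but on `[0, t]` both solutions stay in a common
closed ball, on which it is Lipschitz. -/
theorem IsRiccatiSolution.unique {b p q v : ℝ} {y z : ℝ → ℝ}
    (hy : IsRiccatiSolution b p q v y) (hz : IsRiccatiSolution b p q v z) {t : ℝ} (ht : 0 ≤ t) :
    y t = z t := by
  have hyc := hy.continuousOn.mono (show Icc 0 t ⊆ Ici 0 from fun s hs => hs.1)
  have hzc := hz.continuousOn.mono (show Icc 0 t ⊆ Ici 0 from fun s hs => hs.1)
  obtain ⟨A, hA⟩ := isCompact_Icc.exists_bound_of_continuousOn hyc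
  obtain ⟨B, hB⟩ := isCompact_Icc.exists_bound_of_continuousOn hzc
  have hC1 : ContDiff ℝ 1 fun x : ℝ => b * (p * v - x + q * x ^ 2) := by fun_prop
  obtain ⟨K, hK⟩ := hC1.locallyLipschitz.locallyLipschitzOn.exists_lipschitzOnWith_of_compact
    (isCompact_closedBall (0 : ℝ) (max A B))
  refine ODE_solution_unique_of_mem_Icc_right
    (v := fun _ x => b * (p * v - x + q * x ^ 2)) (s := fun _ => Metric.closedBall 0 (max A B))
    (K := K) (a := 0) (b := t) (fun _ _ => hK) hyc (fun s hs => ?_) (fun s hs => ?_) hzc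
    (fun s hs => ?_) (fun s hs => ?_) (hy.1.trans hz.1.symm) ⟨ht, le_rfl⟩
  · exact (hy.2 s hs.1).mono (Ici_subset_Ici.mpr hs.1)
  · exact mem_closedBall_zero_iff.mpr ((hA s ⟨hs.1, hs.2.le⟩).trans (le_max_left _ _))
  · exact (hz.2 s hs.1).mono (Ici_subset_Ici.mpr hs.1)
  · exact mem_closedBall_zero_iff.mpr ((hB s ⟨hs.1, hs.2.le⟩).trans (le_max_right _ _))

/-- The closed form of the generating function of the death number. -/
noncomputable def riccatiClosedForm (b p q v t : ℝ) : ℝ :=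
  rootBeta p q v + (rootAlpha p q v - rootBeta p q v) /
    (1 + (rootAlpha p q v - 1) / (1 - rootBeta p q v) *
      Real.exp ((rootAlpha p q v - rootBeta p q v) * b * q * t))

section Roots

variable {p q v : ℝ}

theorem rootAlpha_add_rootBeta (hq : 0 < q) : q * (rootAlpha p q v + rootBeta p q v) = 1 := by
  rw [rootAlpha, rootBeta]; field_simp; ring

theorem rootAlpha_mul_rootBeta (hq : 0 < q) (hD : 0 ≤ 1 - 4 * p * q * v) :
    q * (rootAlpha p q v * rootBeta p q v) = p * v := by
  have hs := Real.sq_sqrt hD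
  rw [rootAlpha, rootBeta, div_mul_div_comm, mul_div_assoc', div_eq_iff (by positivity)]
  linear_combination (-q) * hs

theorem discrim_pos (hp : 0 < p) (hq : 0 < q) (hpq : p + q = 1) (hv1 : v < 1) :
    0 < 1 - 4 * p * q * v := by
  have : 0 < p * q := mul_pos hp hq
  nlinarith [sq_nonneg (p - q), mul_pos this (sub_pos.mpr hv1)]

theorem roots_bounds (hp : 0 < p) (hq : 0 < q) (hpq : p + q = 1) (hv0 : 0 ≤ v) (hv1 : v < 1) :
    0 ≤ rootBeta p q v ∧ rootBeta p q v < 1 ∧ 1 < rootAlpha p q v := by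
  have hD := discrim_pos hp hq hpq hv1
  have hsum := rootAlpha_add_rootBeta (p := p) (v := v) hq
  have hprod := rootAlpha_mul_rootBeta hq hD.le
  have hlt : rootBeta p q v < rootAlpha p q v := by
    rw [rootAlpha, rootBeta]
    have := Real.sqrt_pos.mpr hD
    gcongr
    linarith
  -- The quadratic at `1` equals `-p (1 - v) < 0`, so `1` lies strictly between the roots.
  have hneg : (1 - rootAlpha p q v) * (1 - rootBeta p q v) < 0 := by
    have : q * ((1 - rootAlpha p q v) * (1 - rootBeta p q v)) < 0 := by nlinarith
    by_contra! h
    nlinarith [mul_nonneg hq.le h]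
  have hβ : rootBeta p q v < 1 := by
    by_contra! h
    nlinarith
  refine ⟨?_, hβ, by nlinarith⟩
  rw [rootBeta]
  refine div_nonneg (sub_nonneg.mpr (Real.sqrt_le_one.mpr ?_)) (by linarith)
  have : 0 ≤ p * q * v := by positivity
  linarith

/-- The exponential is at least `1`, so the value lies between `β ≥ 0` and the initial value `1`.
The comparison below needs `y ^ j` in `[0, 1]`. -/
theorem riccatiClosedForm_mem_Icc {b : ℝ} (hb : 0 < b) (hp : 0 < p) (hq : 0 < q)
    (hpq : p + q = 1) (hv0 : 0 ≤ v) (hv1 : v < 1) {t : ℝ} (ht : 0 ≤ t) :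
    riccatiClosedForm b p q v t ∈ Icc (0 : ℝ) 1 := by
  obtain ⟨hβ0, hβ1, hα⟩ := roots_bounds hp hq hpq hv0 hv1
  rw [riccatiClosedForm]
  set α := rootAlpha p q v
  set β := rootBeta p q v
  have hαβ : 0 < α - β := by linarith
  have h1β : 0 < 1 - β := by linarith
  have hc : 0 < (α - 1) / (1 - β) := div_pos (by linarith) h1β
  have hE : 1 ≤ Real.exp ((α - β) * b * q * t) := Real.one_le_exp (by positivity)
  have hden : 1 + (α - 1) / (1 - β) ≤ 1 + (α - 1) / (1 - β) * Real.exp ((α - β) * b * q * t) := by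
    nlinarith
  have h1c : 1 + (α - 1) / (1 - β) = (α - β) / (1 - β) := by field_simp; ring
  constructor
  · have : 0 < (α - β) / (1 + (α - 1) / (1 - β) * Real.exp ((α - β) * b * q * t)) := by positivity
    linarith
  · have : (α - β) / (1 + (α - 1) / (1 - β) * Real.exp ((α - β) * b * q * t)) ≤ 1 - β := by
      rw [div_le_iff₀ (by positivity)]
      calc α - β = (1 - β) * ((α - β) / (1 - β)) := by field_simp
        _ ≤ _ := by rw [← h1c]; gcongr
    linarith

theorem isRiccatiSolution_closedForm {b : ℝ} (hp : 0 < p) (hq : 0 < q)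
    (hpq : p + q = 1) (hv0 : 0 ≤ v) (hv1 : v < 1) :
    IsRiccatiSolution b p q v (riccatiClosedForm b p q v) := by
  obtain ⟨hβ0, hβ1, hα⟩ := roots_bounds hp hq hpq hv0 hv1
  have hsum := rootAlpha_add_rootBeta (p := p) (v := v) hq
  have hprod := rootAlpha_mul_rootBeta hq (discrim_pos hp hq hpq hv1).le
  unfold riccatiClosedForm
  set α := rootAlpha p q v
  set β := rootBeta p q v
  have hαβ : 0 < α - β := by linarith
  have h1β : 0 < 1 - β := by linarith
  have hc : 0 < (α - 1) / (1 - β) := div_pos (by linarith) h1β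
  have h1c : 1 + (α - 1) / (1 - β) = (α - β) / (1 - β) := by field_simp; ring
  constructor
  · simp only [mul_zero, Real.exp_zero, mul_one]
    rw [h1c]
    field_simp
    ring
  · intro t _
    set c := (α - 1) / (1 - β)
    have hE := Real.exp_pos ((α - β) * b * q * t)
    have hden : 1 + c * Real.exp ((α - β) * b * q * t) ≠ 0 := by positivity
    have hd : HasDerivAt (fun t => β + (α - β) / (1 + c * Real.exp ((α - β) * b * q * t)))
        (-((α - β) * (c * (Real.exp ((α - β) * b * q * t) * ((α - β) * b * q)))) /
          (1 + c * Real.exp ((α - β) * b * q * t)) ^ 2) t := by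
      have h1 : HasDerivAt (fun t => (α - β) * b * q * t) ((α - β) * b * q) t := by
        simpa using (hasDerivAt_id t).const_mul ((α - β) * b * q)
      have h2 := ((h1.exp.const_mul c).const_add 1)
      have h3 := ((hasDerivAt_const t (α - β)).div h2 hden).const_add β
      simpa using h3
    refine (hd.congr_deriv ?_).hasDerivWithinAt
    set E := Real.exp ((α - β) * b * q * t)
    -- Vieta's relations factor the right-hand side as `q (y - α) (y - β)`.
    have hpv : p * v - (β + (α - β) / (1 + c * E)) + q * (β + (α - β) / (1 + c * E)) ^ 2 =
        q * ((β + (α - β) / (1 + c * E)) - α) * ((β + (α - β) / (1 + c * E)) - β) := by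
      linear_combination (-1) * hprod + (β + (α - β) / (1 + c * E)) * hsum
    rw [hpv]
    field_simp
    ring

theorem isRiccatiSolution_one {b : ℝ} (hpq : p + q = 1) :
    IsRiccatiSolution b p q 1 (fun _ => 1) := by
  refine ⟨rfl, fun t _ => ?_⟩
  rw [show b * (p * 1 - 1 + q * 1 ^ 2) = 0 by linear_combination b * hpq]
  exact hasDerivWithinAt_const _ _ _

/-- The case `v = 1` is separate: for `p ≥ q` the smaller root is then `1` and the closed form
divides by zero. -/
theorem exists_isRiccatiSolution {b : ℝ} (hb : 0 < b) (hp : 0 < p) (hq : 0 < q)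
    (hpq : p + q = 1) (hv : v ∈ Icc (0 : ℝ) 1) :
    ∃ y, IsRiccatiSolution b p q v y ∧ ∀ t, 0 ≤ t → y t ∈ Icc (0 : ℝ) 1 := by
  rcases hv.2.lt_or_eq with hv1 | rfl
  · exact ⟨_, isRiccatiSolution_closedForm hp hq hpq hv.1 hv1, fun t ht =>
      riccatiClosedForm_mem_Icc hb hp hq hpq hv.1 hv1 ht⟩
  · exact ⟨_, isRiccatiSolution_one hpq, fun _ _ => ⟨zero_le_one, le_rfl⟩⟩

theorem riccatiClosedForm_one {b t : ℝ} (hq : 0 < q) (hpq : p + q = 1) (hlt : p < q) :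
    riccatiClosedForm b p q 1 t = 1 := by
  have hs : √(1 - 4 * p * q * 1) = q - p := by
    rw [show 1 - 4 * p * q * 1 = (q - p) ^ 2 by linear_combination (-(1 + p + q)) * hpq,
      Real.sqrt_sq (by linarith)]
  have hα : rootAlpha p q 1 = 1 := by
    rw [rootAlpha, hs, div_eq_one_iff_eq (by positivity)]
    linarith
  rw [riccatiClosedForm, hα]
  simp

theorem riccatiClosedForm_zero {b t : ℝ} (hp : 0 < p) (hq : 0 < q) (hpq : p + q = 1) :
    riccatiClosedForm b p q 0 t = 1 / (q + p * Real.exp (b * t)) := by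
  have hα : rootAlpha p q 0 = 1 / q := by
    rw [rootAlpha]; simp; field_simp; norm_num
  have hβ : rootBeta p q 0 = 0 := by rw [rootBeta]; simp
  rw [riccatiClosedForm, hα, hβ]
  have hE := Real.exp_pos (b * t)
  have h1 : (1 / q - 0) * b * q * t = b * t := by field_simp; ring
  obtain rfl : p = 1 - q := by linarith
  rw [h1]
  field_simp
  ring

end Roots

/-! ### Comparison of the sampled chain with powers of the solution. -/

/-- The factor by which a transition from `i` to `j` multiplies `v ^ (number of deaths)`. -/
noncomputable def deathWeight (v : ℝ) (i j : ℕ) : ℝ := if i = j + 1 then v else 1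

/-- The indicator of transitions to states that are at most `K`. -/
noncomputable def confinedWeight (K : ℕ) (_i j : ℕ) : ℝ := if j ≤ K then 1 else 0

theorem deathWeight_mem_Icc {v : ℝ} (hv : v ∈ Icc (0 : ℝ) 1) (i j : ℕ) :
    deathWeight v i j ∈ Icc (0 : ℝ) 1 := by
  rw [deathWeight]; split_ifs
  exacts [hv, ⟨zero_le_one, le_rfl⟩]

theorem confinedWeight_mem_Icc (K i j : ℕ) : confinedWeight K i j ∈ Icc (0 : ℝ) 1 := by
  rw [confinedWeight]; split_ifs <;> simp

theorem pow_mem_Icc_zero_one {y : ℝ} (hy : y ∈ Icc (0 : ℝ) 1) (n : ℕ) : y ^ n ∈ Icc (0 : ℝ) 1 :=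
  ⟨pow_nonneg hy.1 n, pow_le_one₀ hy.1 hy.2⟩

/-- Powers of a solution of the Riccati equation have a first order expansion that is uniform on
bounded intervals. -/
theorem IsRiccatiSolution.eventually_abs_pow_sub_le {b p q v : ℝ} {y : ℝ → ℝ}
    (hy : IsRiccatiSolution b p q v y) (t : ℝ) (i : ℕ) {ε : ℝ} (hε : 0 < ε) :
    ∀ᶠ d in 𝓝[>] (0 : ℝ), ∀ s, 0 ≤ s → s + d ≤ t →
      |y (s + d) ^ i - (y s ^ i + d * (i * y s ^ (i - 1) *
        (b * (p * v - y s + q * y s ^ 2))))| ≤ ε * d := by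
  set ψ : ℝ → ℝ := fun s => i * y s ^ (i - 1) * (b * (p * v - y s + q * y s ^ 2)) with hψ
  have hyc : ContinuousOn y (Icc 0 t) := hy.continuousOn.mono fun s hs => hs.1
  have hψc : ContinuousOn ψ (Icc 0 t) := by fun_prop
  have huc := isCompact_Icc.uniformContinuousOn_of_continuous hψc
  rw [Metric.uniformContinuousOn_iff] at huc
  obtain ⟨δ, hδ, hunif⟩ := huc ε hε
  filter_upwards [Ioo_mem_nhdsGT hδ] with d ⟨hd0, hdδ⟩ s hs hsd
  have hsub : Icc s (s + d) ⊆ Icc 0 t := Icc_subset_Icc hs hsd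
  -- By the mean value theorem the increment is `ψ ξ * d`; uniform continuity of `ψ` replaces `ξ` by
  -- `s`, uniformly in `s`.
  obtain ⟨ξ, hξ, heq⟩ := exists_hasDerivAt_eq_slope (fun u => y u ^ i) ψ
    (by linarith : s < s + d) ((hyc.mono hsub).pow i) fun u hu => by
      have hu0 : 0 < u := hs.trans_lt hu.1
      exact ((hy.2 u hu0.le).hasDerivAt (Ici_mem_nhds hu0)).pow i
  have hdist := hunif ξ (hsub (Ioo_subset_Icc_self hξ)) s (hsub ⟨le_rfl, by linarith⟩) (by
    rw [Real.dist_eq, abs_of_nonneg (by linarith [hξ.1])]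
    linarith [hξ.2])
  rw [Real.dist_eq] at hdist
  rw [add_sub_cancel_left, eq_div_iff hd0.ne'] at heq
  calc |y (s + d) ^ i - (y s ^ i + d * ψ s)| = |(ψ ξ - ψ s) * d| := by
        congr 1; linear_combination (-1) * heq
    _ = |ψ ξ - ψ s| * d := by rw [abs_mul, abs_of_pos hd0]
    _ ≤ ε * d := by gcongr

theorem IsRiccatiSolution.eventually_one_step {P : ℝ → ℕ → ℕ → ℝ} (hP : IsTransitionFunction P)
    {b p q v : ℝ} (hpq : p + q = 1)
    (hQ : HasQMatrix P (branchingQMatrix (birthDeathRates b p q))) (hv : v ∈ Icc (0 : ℝ) 1)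
    {y : ℝ → ℝ} (hy : IsRiccatiSolution b p q v y) (hy01 : ∀ t, 0 ≤ t → y t ∈ Icc (0 : ℝ) 1)
    (t : ℝ) (i : ℕ) {ε : ℝ} (hε : 0 < ε) :
    ∀ᶠ d in 𝓝[>] (0 : ℝ), ∀ s, 0 ≤ s → s + d ≤ t →
      |∑' j, P d i j * (deathWeight v i j * y s ^ j) - y (s + d) ^ i| ≤ ε * d := by
  filter_upwards [hQ.eventually_abs_tsum_sub_le hP hpq i (half_pos hε),
    hy.eventually_abs_pow_sub_le t i (half_pos hε)] with d h1 h2 s hs hsd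
  have h1 := h1 (fun j => deathWeight v i j * y s ^ j) fun j =>
    mul_mem_Icc_zero_one (deathWeight_mem_Icc hv i j) (pow_mem_Icc_zero_one (hy01 s hs) j)
  have h2 := h2 s hs hsd
  -- The key identity: on powers of `y`, the weighted generator acts as the Riccati vector field.
  have hgen : b * i * (p * (deathWeight v i (i - 1) * y s ^ (i - 1)) -
      deathWeight v i i * y s ^ i + q * (deathWeight v i (i + 1) * y s ^ (i + 1))) =
      i * y s ^ (i - 1) * (b * (p * v - y s + q * y s ^ 2)) := by
    rcases i with _ | n
    · simp
    · simp [deathWeight]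
      ring
  have hdiag : deathWeight v i i * y s ^ i = y s ^ i := by simp [deathWeight]
  rw [hgen, hdiag] at h1
  rw [abs_le] at h1 h2 ⊢
  constructor <;> linarith

/-- Comparison of the weighted sampled chain with a solution of the Riccati equation: the error is
controlled as long as the chain stays in `{0, …, K}`. -/
theorem abs_sampledWeight_sub_le {P : ℝ → ℕ → ℕ → ℝ} (hP : IsTransitionFunction P)
    {v : ℝ} (hv : v ∈ Icc (0 : ℝ) 1) {y : ℝ → ℝ} (hy0 : y 0 = 1)
    (hy01 : ∀ t, 0 ≤ t → y t ∈ Icc (0 : ℝ) 1) {t h ε : ℝ} (hh : 0 ≤ h) (hε : 0 ≤ ε) {K : ℕ}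
    (hstep : ∀ i ≤ K, ∀ s, 0 ≤ s → s + h ≤ t →
      |∑' j, P h i j * (deathWeight v i j * y s ^ j) - y (s + h) ^ i| ≤ ε * h)
    (m : ℕ) (hm : m * h ≤ t) (i : ℕ) (hi : i ≤ K) :
    |sampledWeight P h (deathWeight v) m i - y (m * h) ^ i| ≤
      m * (ε * h) + 1 - sampledWeight P h (confinedWeight K) m i := by
  induction m generalizing i with
  | zero => simp [sampledWeight, hy0]
  | succ m ih =>
    have hcast : ((m + 1 : ℕ) : ℝ) * h = m * h + h := by push_cast; ring
    have hmh : 0 ≤ (m : ℝ) * h := by positivity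
    rw [hcast] at hm ⊢
    have ih := fun i hi => ih (by linarith) i hi
    have hV := fun j => sampledWeight_mem_Icc hP hh (deathWeight_mem_Icc hv) m j
    have hW := fun j => sampledWeight_mem_Icc hP hh (confinedWeight_mem_Icc K) m j
    have hY := fun j => pow_mem_Icc_zero_one (hy01 (m * h) hmh) j
    have hφV := hP.summable_mul hh i fun j => mul_mem_Icc_zero_one (deathWeight_mem_Icc hv i j) (hV j)
    have hφY := hP.summable_mul hh i fun j => mul_mem_Icc_zero_one (deathWeight_mem_Icc hv i j) (hY j)
    have hψW := hP.summable_mul hh i fun j => mul_mem_Icc_zero_one (confinedWeight_mem_Icc K i j) (hW j)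
    have hbound : HasSum (fun j => P h i j * (m * (ε * h) + 1) -
        P h i j * (confinedWeight K i j * sampledWeight P h (confinedWeight K) m j))
        (1 * (m * (ε * h) + 1) - sampledWeight P h (confinedWeight K) (m + 1) i) :=
      ((hP.hasSum_one h hh i).mul_right _).sub hψW.hasSum
    have hmain : |sampledWeight P h (deathWeight v) (m + 1) i -
        ∑' j, P h i j * (deathWeight v i j * y (m * h) ^ j)| ≤
        1 * (m * (ε * h) + 1) - sampledWeight P h (confinedWeight K) (m + 1) i := by
      rw [sampledWeight, ← hφV.tsum_sub hφY, ← Real.norm_eq_abs]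
      refine tsum_of_norm_bounded hbound fun j => ?_
      have hPj := hP.nonneg h hh i j
      rw [← mul_sub, ← mul_sub, ← mul_sub, norm_mul, norm_mul, Real.norm_of_nonneg hPj,
        Real.norm_of_nonneg (deathWeight_mem_Icc hv i j).1, Real.norm_eq_abs]
      refine mul_le_mul_of_nonneg_left ?_ hPj
      refine (mul_le_of_le_one_left (abs_nonneg _) (deathWeight_mem_Icc hv i j).2).trans ?_
      rw [confinedWeight]
      -- States `j ≤ K` use the induction hypothesis; for `j > K` the confined weight is `0` and the
      -- trivial bound `1` suffices.
      split_ifs with hj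
      · rw [one_mul]; exact ih j hj
      · rw [zero_mul, sub_zero]
        have : 0 ≤ (m : ℝ) * (ε * h) := by positivity
        rw [abs_le]
        constructor <;> linarith [(hV j).1, (hV j).2, (hY j).1, (hY j).2]
    have herr := hstep i hi (m * h) hmh hm
    push_cast
    rw [abs_le] at hmain herr ⊢
    constructor <;> linarith

/-! ### Passage to the limit in the generating function. -/

section DeathNumber

variable {Ω : Type*} [MeasurableSpace Ω] {μ : Measure Ω} {X : ℝ → Ω → ℕ} {P : ℝ → ℕ → ℕ → ℝ}

theorem IsMarkovChain.aemeasurable_deathNumber (hX : IsMarkovChain μ X P)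
    (hpath : ∀ᵐ ω ∂μ, IsCadlagPath (fun s => X s ω)) {t : ℝ} (ht : 0 ≤ t) :
    AEMeasurable (deathNumber X t) μ := by
  refine aemeasurable_of_tendsto_metrizable_ae atTop
    (f := fun (N : ℕ) ω => sampledDeaths (fun s => X s ω) (t / N) N) (fun N => ?_) ?_
  · refine (Finset.measurable_sum _ fun k _ => ?_).aemeasurable
    have hN : 0 ≤ t / N := by positivity
    exact (measurable_of_countable (fun z : ℕ × ℕ => if z.1 = z.2 + 1 then 1 else 0)).comp
        ((hX.measurable_mul hN k).prodMk (hX.measurable_mul hN (k + 1)))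
  · filter_upwards [hpath] with ω hω
    refine tendsto_nhds_of_eventually_eq ?_
    filter_upwards [(hω.deathTimes_eq_sampled ht).2] with N hN
    exact hN.symm

theorem prod_deathWeight (x : ℝ → ℕ) (v h : ℝ) (N : ℕ) :
    ∏ k ∈ Finset.range N, deathWeight v (x (k * h)) (x ((k + 1 : ℕ) * h)) =
      v ^ sampledDeaths x h N := by
  rw [sampledDeaths, ← Finset.prod_pow_eq_pow_sum]
  refine Finset.prod_congr rfl fun k _ => ?_
  rw [deathWeight]
  split_ifs <;> simp

variable [IsProbabilityMeasure μ]

theorem IsMarkovChain.tendsto_sampledWeight (hX : IsMarkovChain μ X P)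
    (hP : IsTransitionFunction P) (hpath : ∀ᵐ ω ∂μ, IsCadlagPath (fun s => X s ω))
    {i₀ : ℕ} (hX0 : ∀ᵐ ω ∂μ, X 0 ω = i₀) {v : ℝ} (hv : v ∈ Icc (0 : ℝ) 1) {t : ℝ} (ht : 0 ≤ t) :
    Tendsto (fun N : ℕ => sampledWeight P (t / N) (deathWeight v) N i₀) atTop
      (𝓝 (deathPGF μ X t v)) := by
  have hN : ∀ N : ℕ, 0 ≤ t / N := fun N => by positivity
  have heq : ∀ N : ℕ, sampledWeight P (t / N) (deathWeight v) N i₀ =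
      ∫ ω, v ^ sampledDeaths (fun s => X s ω) (t / N) N ∂μ := fun N => by
    rw [← hX.integral_prod hP hX0 (hN N) (deathWeight_mem_Icc hv)]
    exact integral_congr_ae (Eventually.of_forall fun ω => prod_deathWeight (fun s => X s ω) v _ N)
  simp only [heq]
  refine tendsto_integral_of_dominated_convergence (fun _ => 1) (fun N => ?_)
    (integrable_const 1) (fun N => Eventually.of_forall fun ω => ?_) ?_
  · refine ((measurable_of_countable fun n : ℕ => v ^ n).comp
      (Finset.measurable_sum _ fun k _ => ?_)).aestronglyMeasurable
    exact (measurable_of_countable (fun z : ℕ × ℕ => if z.1 = z.2 + 1 then 1 else 0)).comp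
        ((hX.measurable_mul (hN N) k).prodMk (hX.measurable_mul (hN N) (k + 1)))
  · rw [Real.norm_of_nonneg (pow_nonneg hv.1 _)]
    exact pow_le_one₀ hv.1 hv.2
  · filter_upwards [hpath] with ω hω
    refine tendsto_nhds_of_eventually_eq ?_
    filter_upwards [(hω.deathTimes_eq_sampled ht).2] with N hN
    rw [deathNumber, hN]

/-- The event that one of the samples of `X` on a grid `{k t / N | k ≤ N}` exceeds `K`. -/
def exceedsOnGrid (X : ℝ → Ω → ℕ) (t : ℝ) (K : ℕ) : Set Ω :=
  ⋃ N : ℕ, ⋃ k ∈ Finset.range (N + 1), {ω | K < X (k * (t / N)) ω}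

omit [IsProbabilityMeasure μ] in
theorem IsMarkovChain.measurableSet_exceedsOnGrid (hX : IsMarkovChain μ X P) {t : ℝ} (ht : 0 ≤ t)
    (K : ℕ) : MeasurableSet (exceedsOnGrid X t K) :=
  MeasurableSet.iUnion fun N => Finset.measurableSet_biUnion _ fun k _ =>
    measurableSet_lt measurable_const (hX.measurable_mul (by positivity) k)

/-- A càdlàg path is bounded on `[0, t]`, so these decreasing events have null intersection. -/
theorem IsMarkovChain.tendsto_exceedsOnGrid (hX : IsMarkovChain μ X P)
    (hpath : ∀ᵐ ω ∂μ, IsCadlagPath (fun s => X s ω)) {t : ℝ} (ht : 0 ≤ t) :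
    Tendsto (fun K => μ.real (exceedsOnGrid X t K)) atTop (𝓝 0) := by
  have hanti : Antitone (exceedsOnGrid X t) := fun K L hKL =>
    iUnion_mono fun N => iUnion₂_mono fun k _ ω (hω : L < _) => hKL.trans_lt hω
  have hnull : μ (⋂ K, exceedsOnGrid X t K) = 0 := by
    refine measure_mono_null (t := {ω | ¬ IsCadlagPath (fun s => X s ω)}) ?_ hpath
    intro ω hω hcad
    obtain ⟨K, hK⟩ := hcad.exists_le t
    have := mem_iInter.mp hω K
    simp only [exceedsOnGrid, mem_iUnion, mem_ofPred_eq, Finset.mem_range] at this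
    obtain ⟨N, k, hk, hlt⟩ := this
    refine absurd (hK (k * (t / N)) ⟨by positivity, ?_⟩) (not_le.mpr hlt)
    rcases N.eq_zero_or_pos with rfl | hN
    · simpa using ht
    · rw [mul_div_assoc', div_le_iff₀ (by positivity), mul_comm]
      have : (k : ℝ) ≤ N := by exact_mod_cast Nat.lt_succ_iff.mp hk
      gcongr
  have := tendsto_measure_iInter_atTop
    (fun K => (hX.measurableSet_exceedsOnGrid ht K).nullMeasurableSet) hanti
    ⟨0, measure_ne_top μ _⟩
  rw [hnull] at this
  exact (ENNReal.tendsto_toReal ENNReal.zero_ne_top).comp this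

/-- The weight is the probability that the samples `1, …, N` stay at most `K`. The bound is free of
`N`, so `N → ∞` can be taken before `K → ∞`. -/
theorem IsMarkovChain.one_sub_sampledWeight_le (hX : IsMarkovChain μ X P)
    (hP : IsTransitionFunction P) {i₀ : ℕ} (hX0 : ∀ᵐ ω ∂μ, X 0 ω = i₀) {t : ℝ} (ht : 0 ≤ t)
    (K N : ℕ) :
    1 - sampledWeight P (t / N) (confinedWeight K) N i₀ ≤ μ.real (exceedsOnGrid X t K) := by
  have hh : 0 ≤ t / N := by positivity
  have hA := hX.measurableSet_exceedsOnGrid ht K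
  have hmeas : Measurable fun ω => ∏ k ∈ Finset.range N,
      confinedWeight K (X (k * (t / N)) ω) (X ((k + 1 : ℕ) * (t / N)) ω) :=
    Finset.measurable_prod _ fun k _ =>
      (measurable_of_countable (fun z : ℕ × ℕ => confinedWeight K z.1 z.2)).comp
        ((hX.measurable_mul hh k).prodMk (hX.measurable_mul hh (k + 1)))
  have hle : ∀ ω, (exceedsOnGrid X t K)ᶜ.indicator (fun _ => (1 : ℝ)) ω ≤
      ∏ k ∈ Finset.range N,
        confinedWeight K (X (k * (t / N)) ω) (X ((k + 1 : ℕ) * (t / N)) ω) := by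
    intro ω
    by_cases hω : ω ∈ exceedsOnGrid X t K
    · rw [indicator_of_notMem (by simpa using hω)]
      exact Finset.prod_nonneg fun k _ => (confinedWeight_mem_Icc _ _ _).1
    · rw [indicator_of_mem (by simpa using hω), Finset.prod_eq_one]
      intro k hk
      rw [confinedWeight, if_pos]
      by_contra! hlt
      refine hω (mem_iUnion.mpr ⟨N, mem_iUnion₂.mpr ⟨k + 1, ?_, hlt⟩⟩)
      simpa using hk
  have hint := integral_mono (μ := μ) ((integrable_const (1 : ℝ)).indicator hA.compl)
    (Integrable.of_bound hmeas.aestronglyMeasurable 1 (Eventually.of_forall fun ω => by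
      rw [Real.norm_of_nonneg (Finset.prod_nonneg fun k _ => (confinedWeight_mem_Icc _ _ _).1)]
      exact Finset.prod_le_one (fun k _ => (confinedWeight_mem_Icc _ _ _).1)
        fun k _ => (confinedWeight_mem_Icc _ _ _).2)) hle
  rw [hX.integral_prod hP hX0 hh (confinedWeight_mem_Icc K), integral_indicator_const _ hA.compl,
    probReal_compl_eq_one_sub hA, smul_eq_mul, mul_one] at hint
  linarith

/-- The limits are taken in the order `N → ∞`, `K → ∞`, `ε → 0`; for fixed `K` only finitely many
states need the one-step estimate. -/
theorem deathPGF_eq_of_isRiccatiSolution {b p q : ℝ} (hpq : p + q = 1)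
    (hX : IsMarkovBranchingProcess μ (birthDeathRates b p q) X) (hX0 : ∀ᵐ ω ∂μ, X 0 ω = 1)
    {v : ℝ} (hv : v ∈ Icc (0 : ℝ) 1) {y : ℝ → ℝ} (hy : IsRiccatiSolution b p q v y)
    (hy01 : ∀ t, 0 ≤ t → y t ∈ Icc (0 : ℝ) 1) {t : ℝ} (ht : 0 ≤ t) :
    deathPGF μ X t v = y t := by
  obtain ⟨⟨P, hP, hQ, hM⟩, hpath⟩ := hX
  rcases ht.eq_or_lt with rfl | ht0
  · simp [deathPGF, deathNumber, deathTimes_zero, hy.1]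
  have hlim := hM.tendsto_sampledWeight hP hpath hX0 hv ht
  have hbound : ∀ K : ℕ, 1 ≤ K → ∀ ε > 0,
      |deathPGF μ X t v - y t| ≤ t * ε + μ.real (exceedsOnGrid X t K) := by
    intro K hK ε hε
    refine le_of_tendsto (hlim.sub_const (y t)).abs ?_
    have hev : ∀ᶠ d in 𝓝[>] (0 : ℝ), ∀ i ∈ Iic K, ∀ s, 0 ≤ s → s + d ≤ t →
        |∑' j, P d i j * (deathWeight v i j * y s ^ j) - y (s + d) ^ i| ≤ ε * d :=
      (eventually_all_finite (finite_Iic K)).mpr fun i _ =>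
        hy.eventually_one_step hP hpq hQ hv hy01 t i hε
    have hmesh : Tendsto (fun N : ℕ => t / N) atTop (𝓝[>] 0) :=
      tendsto_nhdsWithin_iff.mpr ⟨tendsto_const_div_atTop_nhds_zero_nat t, by
        filter_upwards [eventually_gt_atTop 0] with N hN
        exact div_pos ht0 (by exact_mod_cast hN)⟩
    filter_upwards [hmesh.eventually hev, eventually_gt_atTop 0] with N hN hN0
    have hNt : (N : ℝ) * (t / N) = t := by field_simp
    have h1 := abs_sampledWeight_sub_le hP hv hy.1 hy01 (by positivity) hε.le hN N hNt.le 1 hK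
    have h2 := hM.one_sub_sampledWeight_le hP hX0 ht K N
    rw [hNt, pow_one, mul_left_comm, hNt] at h1
    linarith [mul_comm t ε]
  have hK : ∀ ε > 0, |deathPGF μ X t v - y t| ≤ t * ε := by
    intro ε hε
    have := (hM.tendsto_exceedsOnGrid hpath ht).const_add (t * ε)
    rw [add_zero] at this
    refine ge_of_tendsto this ?_
    filter_upwards [eventually_ge_atTop 1] with K hK using hbound K hK ε hε
  have hzero : |deathPGF μ X t v - y t| ≤ 0 := by
    refine le_of_forall_pos_le_add fun ε hε => ?_
    have := hK (ε / t) (by positivity)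
    rwa [mul_div_cancel₀ _ ht0.ne', ← zero_add ε] at this
  exact sub_eq_zero.mp (abs_nonpos_iff.mp hzero)

end DeathNumber

/-! ### Power series and the law of the death number. -/

/-- A power series that vanishes on `(0, 1)` has zero coefficients. -/
theorem eq_zero_of_hasSum_mul_pow {d : ℕ → ℝ}
    (h : ∀ v ∈ Ioo (0 : ℝ) 1, HasSum (fun n => d n * v ^ n) 0) (n : ℕ) : d n = 0 := by
  induction n using Nat.strong_induction_on with
  | _ n ih =>
    have habs : Summable fun k => |d (k + (n + 1))| * (1 / 2 : ℝ) ^ k := by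
      have := ((h (1 / 2) ⟨by norm_num, by norm_num⟩).summable.abs.comp_injective
        (add_left_injective (n + 1))).mul_right ((2 : ℝ) ^ (n + 1))
      refine this.congr fun k => ?_
      simp only [Function.comp_apply, abs_mul, abs_pow]
      rw [abs_of_pos (by norm_num : (0 : ℝ) < 1 / 2), pow_add, mul_assoc, mul_assoc, ← mul_pow]
      norm_num
    set S := ∑' k, |d (k + (n + 1))| * (1 / 2 : ℝ) ^ k
    -- The lower coefficients vanish by induction, so `d n * v ^ n` is minus the tail, which is at
    -- most `v ^ (n + 1) * S`.
    have hbound : ∀ v ∈ Ioo (0 : ℝ) (1 / 2), |d n| ≤ v * S := by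
      intro v hv
      have hsum := h v ⟨hv.1, hv.2.trans (by norm_num)⟩
      have hsplit := hsum.summable.sum_add_tsum_nat_add (n + 1)
      rw [hsum.tsum_eq, Finset.sum_range_succ, Finset.sum_eq_zero fun k hk => by
        rw [ih k (Finset.mem_range.mp hk), zero_mul], zero_add] at hsplit
      have htail : |∑' k, d (k + (n + 1)) * v ^ (k + (n + 1))| ≤ v ^ (n + 1) * S := by
        rw [← Real.norm_eq_abs]
        refine tsum_of_norm_bounded (habs.hasSum.mul_left _) fun k => ?_
        rw [Real.norm_eq_abs, abs_mul, abs_of_pos (pow_pos hv.1 _), pow_add, ← mul_assoc,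
          mul_comm (v ^ (n + 1))]
        have : v ^ k ≤ (1 / 2 : ℝ) ^ k := pow_le_pow_left₀ hv.1.le hv.2.le k
        have := pow_pos hv.1 (n + 1)
        gcongr
      have hvn := pow_pos hv.1 n
      rw [← neg_eq_of_add_eq_zero_right hsplit, abs_neg, abs_mul, abs_of_pos hvn, pow_succ,
        mul_comm, mul_assoc] at htail
      exact le_of_mul_le_mul_left htail hvn
    have hlim : Tendsto (fun v : ℝ => v * S) (𝓝[>] 0) (𝓝 0) := by
      have : Tendsto (fun v : ℝ => v * S) (𝓝 0) (𝓝 (0 * S)) := tendsto_id.mul_const S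
      rw [zero_mul] at this
      exact this.mono_left nhdsWithin_le_nhds
    have : |d n| ≤ 0 := ge_of_tendsto hlim
      (eventually_of_mem (Ioo_mem_nhdsGT (by norm_num : (0 : ℝ) < 1 / 2)) hbound)
    exact abs_nonpos_iff.mp this

section Prob

variable {Ω : Type*} [MeasurableSpace Ω] {μ : Measure Ω} {X : ℝ → Ω → ℕ}

omit [MeasurableSpace Ω] in
theorem deathNumber_eq_zero_of_nonpos {t : ℝ} (ht : t ≤ 0) (ω : Ω) : deathNumber X t ω = 0 := by
  rw [deathNumber, (eq_empty_of_subset_empty ((deathTimes_mono _ ht).trans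
    (deathTimes_zero _).subset)), ncard_empty]

theorem aemeasurable_deathNumber_of_nonneg (h : ∀ t, 0 ≤ t → AEMeasurable (deathNumber X t) μ)
    (t : ℝ) : AEMeasurable (deathNumber X t) μ := by
  rcases le_total 0 t with ht | ht
  · exact h t ht
  · rw [show deathNumber X t = fun _ => 0 from funext (deathNumber_eq_zero_of_nonpos ht)]
    exact aemeasurable_const

variable [IsProbabilityMeasure μ]

theorem hasSum_deathProb_mul_pow {t : ℝ} (hY : AEMeasurable (deathNumber X t) μ) {v : ℝ}
    (hv : v ∈ Icc (0 : ℝ) 1) :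
    HasSum (fun n => deathProb μ X n t * v ^ n) (deathPGF μ X t v) := by
  have hset : ∀ n, NullMeasurableSet {ω | deathNumber X t ω = n} μ := fun n =>
    hY.nullMeasurableSet_preimage (measurableSet_singleton n)
  have hbd : ∀ n ω, ({ω | deathNumber X t ω = n} : Set Ω).indicator (fun _ => (1 : ℝ)) ω =
      if n = deathNumber X t ω then 1 else 0 := fun n ω => by
    simp [indicator_apply, eq_comm]
  have := hasSum_integral_of_dominated_convergence (μ := μ)
    (F := fun n => ({ω | deathNumber X t ω = n} : Set Ω).indicator fun _ => v ^ n)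
    (f := fun ω => v ^ deathNumber X t ω)
    (fun n => ({ω | deathNumber X t ω = n} : Set Ω).indicator fun _ => (1 : ℝ))
    (fun n => (aestronglyMeasurable_const).indicator₀ (hset n))
    (fun n => Eventually.of_forall fun ω => by
      rw [norm_indicator_eq_indicator_norm]
      refine indicator_le_indicator ?_
      rw [Real.norm_of_nonneg (pow_nonneg hv.1 n)]
      exact pow_le_one₀ hv.1 hv.2)
    (Eventually.of_forall fun ω => by
      simp only [hbd]
      exact (hasSum_ite_eq (deathNumber X t ω) (1 : ℝ)).summable)
    (by
      simp only [hbd, tsum_ite_eq]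
      exact integrable_const 1)
    (Eventually.of_forall fun ω => by
      have : ∀ n, ({ω | deathNumber X t ω = n} : Set Ω).indicator (fun _ => v ^ n) ω =
          if n = deathNumber X t ω then v ^ deathNumber X t ω else 0 := fun n => by
        simp only [indicator_apply, mem_ofPred_eq, eq_comm (a := n)]
        split_ifs with hn
        · rw [hn]
        · rfl
      simp only [this]
      exact hasSum_ite_eq _ _)
  convert! this using 1
  funext n
  rw [integral_indicator₀ (hset n), setIntegral_const, smul_eq_mul]
  rfl

theorem deathPGF_one {t : ℝ} : deathPGF μ X t 1 = 1 := by simp [deathPGF]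

theorem hasSum_deathProb {t : ℝ} (hY : AEMeasurable (deathNumber X t) μ) :
    HasSum (fun n => deathProb μ X n t) 1 := by
  have := hasSum_deathProb_mul_pow hY (v := 1) ⟨zero_le_one, le_rfl⟩
  simpa [deathPGF_one] using this

/-- Almost surely the death number is nondecreasing in `t`, so its distribution function at each `n`
is antitone in `t`, hence Borel; the probabilities are differences of these. -/
theorem measurable_deathProb (hY : ∀ t, AEMeasurable (deathNumber X t) μ)
    (hpath : ∀ᵐ ω ∂μ, IsCadlagPath (fun s => X s ω)) (n : ℕ) :
    Measurable (deathProb μ X n) := by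
  have hmono : ∀ᵐ ω ∂μ, Monotone fun t => deathNumber X t ω := by
    filter_upwards [hpath] with ω hω s t hst
    rcases le_total 0 t with ht | ht
    -- Finiteness is essential: `ncard` of an infinite set is `0`.
    · exact ncard_le_ncard (deathTimes_mono _ hst) (hω.deathTimes_eq_sampled ht).1
    · simp [deathNumber_eq_zero_of_nonpos ht, deathNumber_eq_zero_of_nonpos (hst.trans ht)]
  have hcdf : ∀ n, Measurable fun t => μ.real {ω | deathNumber X t ω ≤ n} := fun n => by
    refine Antitone.measurable fun s t hst => ENNReal.toReal_mono (measure_ne_top μ _)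
      (measure_mono_ae ?_)
    filter_upwards [hmono] with ω hω (hle : _ ≤ n)
    exact (hω hst).trans hle
  rcases n with _ | n
  · have := hcdf 0
    simp only [Nat.le_zero] at this
    exact this
  · have heq : deathProb μ X (n + 1) = fun t =>
        μ.real {ω | deathNumber X t ω ≤ n + 1} - μ.real {ω | deathNumber X t ω ≤ n} := by
      ext t
      have hnull : NullMeasurableSet {ω | deathNumber X t ω ≤ n} μ :=
        (hY t).nullMeasurableSet_preimage measurableSet_Iic
      have hsub : {ω | deathNumber X t ω ≤ n} ⊆ {ω | deathNumber X t ω ≤ n + 1} :=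
        fun ω (hω : _ ≤ n) => hω.trans n.le_succ
      rw [deathProb, measureReal_def, measureReal_def, measureReal_def,
        ← ENNReal.toReal_sub_of_le (measure_mono hsub) (measure_ne_top μ _),
        ← measure_sdiff hsub hnull (measure_ne_top μ _)]
      congr 2
      ext ω
      simp only [Set.mem_sdiff, mem_ofPred_eq]
      omega
    rw [heq]
    exact (hcdf (n + 1)).sub (hcdf n)

end Prob

/-! ### The equations for the probabilities. -/

section Coefficients

/-- The coefficient of `v ^ n` in `b * (p * v - G + q * G ^ 2)`, `G = ∑ n, g n * v ^ n`. -/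
noncomputable def riccatiCoeff (b p q : ℝ) (g : ℕ → ℝ) (n : ℕ) : ℝ :=
  b * ((if n = 1 then p else 0) - g n + q * ∑ k ∈ Finset.range (n + 1), g k * g (n - k))

theorem hasSum_riccatiCoeff {b p q v G : ℝ} {g : ℕ → ℝ} (hv0 : 0 ≤ v) (hg0 : ∀ n, 0 ≤ g n)
    (hG : HasSum (fun n => g n * v ^ n) G) :
    HasSum (fun n => riccatiCoeff b p q g n * v ^ n) (b * (p * v - G + q * G ^ 2)) := by
  have hnorm : Summable fun n => ‖g n * v ^ n‖ := by
    refine hG.summable.congr fun n => ?_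
    rw [Real.norm_of_nonneg (mul_nonneg (hg0 n) (pow_nonneg hv0 n))]
  have hsq := hasSum_sum_range_mul_of_summable_norm hnorm hnorm
  rw [hG.tsum_eq, ← pow_two] at hsq
  convert! (((hasSum_ite_eq 1 (p * v)).sub hG).add (hsq.mul_left q)).mul_left b using 1
  funext n
  have hprod : ∑ k ∈ Finset.range (n + 1), g k * v ^ k * (g (n - k) * v ^ (n - k)) =
      (∑ k ∈ Finset.range (n + 1), g k * g (n - k)) * v ^ n := by
    rw [Finset.sum_mul]
    refine Finset.sum_congr rfl fun k hk => ?_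
    rw [← Nat.add_sub_of_le (Nat.lt_succ_iff.mp (Finset.mem_range.mp hk)), pow_add,
      Nat.add_sub_cancel_left]
    ring
  rw [hprod, riccatiCoeff]
  split_ifs with hn
  · rw [hn]; ring
  · ring

/-- The convolution is at most the total mass `1`. Uniformity in `n` provides the dominating
geometric series for integrating termwise. -/
theorem abs_riccatiCoeff_le {b p q : ℝ} {g : ℕ → ℝ} (hb : 0 ≤ b) (hp : 0 ≤ p) (hq : 0 ≤ q)
    (hg0 : ∀ n, 0 ≤ g n) (hg : HasSum g 1) (n : ℕ) :
    |riccatiCoeff b p q g n| ≤ b * (p + 1 + q) := by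
  have hg1 : ∀ n, g n ≤ 1 := fun n => le_hasSum hg n fun k _ => hg0 k
  have hconv0 : 0 ≤ ∑ k ∈ Finset.range (n + 1), g k * g (n - k) :=
    Finset.sum_nonneg fun k _ => mul_nonneg (hg0 k) (hg0 _)
  have hconv1 : ∑ k ∈ Finset.range (n + 1), g k * g (n - k) ≤ 1 :=
    (Finset.sum_le_sum fun k _ => mul_le_of_le_one_right (hg0 k) (hg1 _)).trans
      (sum_le_hasSum _ (fun k _ => hg0 k) hg)
  have hδ : (0 : ℝ) ≤ (if n = 1 then p else 0) ∧ (if n = 1 then p else 0) ≤ p := by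
    split_ifs <;> simp [hp]
  rw [riccatiCoeff, abs_mul, abs_of_nonneg hb]
  refine mul_le_mul_of_nonneg_left ?_ hb
  have h1 := mul_nonneg hq hconv0
  have h2 := mul_le_mul_of_nonneg_left hconv1 hq
  rw [abs_le]
  constructor <;> linarith [hg0 n, hg1 n, hδ.1, hδ.2]

/-- If the generating function of a sub-probability valued curve solves the Riccati equation, its
coefficients solve the corresponding system of integral equations. -/
theorem eq_add_integral_riccatiCoeff {b p q : ℝ} (hb : 0 ≤ b) (hp : 0 ≤ p) (hq : 0 ≤ q)
    {g : ℕ → ℝ → ℝ} {G : ℝ → ℝ → ℝ} (hg0 : ∀ n s, 0 ≤ g n s) (hg : ∀ s, HasSum (g · s) 1)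
    (hmeas : ∀ n, Measurable (g n))
    (hG : ∀ s, ∀ v ∈ Icc (0 : ℝ) 1, HasSum (fun n => g n s * v ^ n) (G s v))
    (hR : ∀ v ∈ Icc (0 : ℝ) 1, IsRiccatiSolution b p q v (fun s => G s v))
    {t : ℝ} (ht : 0 ≤ t) (n : ℕ) :
    g n t = (if n = 0 then 1 else 0) + ∫ s in (0 : ℝ)..t, riccatiCoeff b p q (g · s) n := by
  rw [← sub_eq_zero]
  refine eq_zero_of_hasSum_mul_pow (d := fun n => g n t - ((if n = 0 then 1 else 0) +
    ∫ s in (0 : ℝ)..t, riccatiCoeff b p q (g · s) n)) (fun v hv => ?_) n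
  have hv' := Ioo_subset_Icc_self hv
  have hcont : ContinuousOn (fun s => G s v) (Icc 0 t) :=
    (hR v hv').continuousOn.mono fun s hs => hs.1
  have hFTC : ∫ s in (0 : ℝ)..t, b * (p * v - G s v + q * G s v ^ 2) = G t v - G 0 v := by
    refine intervalIntegral.integral_eq_sub_of_hasDerivAt_of_le ht hcont (fun s hs =>
      ((hR v hv').2 s hs.1.le).hasDerivAt (Ici_mem_nhds hs.1)) ?_
    refine ContinuousOn.intervalIntegrable ?_
    rw [uIcc_of_le ht]
    fun_prop
  have hint : HasSum (fun n => ∫ s in (0 : ℝ)..t, riccatiCoeff b p q (g · s) n * v ^ n)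
      (∫ s in (0 : ℝ)..t, b * (p * v - G s v + q * G s v ^ 2)) := by
    refine intervalIntegral.hasSum_integral_of_dominated_convergence
      (fun n _ => b * (p + 1 + q) * v ^ n) (fun n => ?_) (fun n => ?_) ?_ ?_ ?_
    · refine Measurable.aestronglyMeasurable ?_
      unfold riccatiCoeff
      fun_prop
    · refine Eventually.of_forall fun s _ => ?_
      rw [norm_mul, Real.norm_of_nonneg (pow_nonneg hv'.1 n)]
      exact mul_le_mul_of_nonneg_right
        (abs_riccatiCoeff_le hb hp hq (fun k => hg0 k s) (hg s) n) (pow_nonneg hv'.1 n)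
    · exact Eventually.of_forall fun s _ =>
        (summable_geometric_of_lt_one hv'.1 hv.2).mul_left _
    · exact intervalIntegrable_const
    · exact Eventually.of_forall fun s _ =>
        hasSum_riccatiCoeff hv'.1 (fun k => hg0 k s) (hG s v hv')
  rw [hFTC, show G 0 v = 1 from (hR v hv').1] at hint
  have := (hG t v hv').sub ((hasSum_ite_eq 0 (1 : ℝ)).add hint)
  rw [add_sub_cancel, sub_self] at this
  convert! this using 1
  funext n
  rw [intervalIntegral.integral_mul_const]
  split_ifs with hn
  · rw [hn]; ring
  · ring

/-- The terms `k = 0` and `k = n` of the convolution both equal `g 0 * g n`, whence the factor `2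
q`. -/
theorem riccatiCoeff_eq {b p q : ℝ} {g : ℕ → ℝ → ℝ} {n : ℕ} (hn : 1 ≤ n) (s : ℝ) :
    riccatiCoeff b p q (g · s) n =
      b * (2 * q * g 0 s - 1) * g n s + recursionTerm b p q g n s := by
  rw [riccatiCoeff, recursionTerm, Finset.sum_range_succ, Finset.range_eq_Ico,
    Finset.sum_eq_sum_Ico_succ_bot (by omega : 0 < n), Nat.sub_self, Nat.sub_zero]
  split_ifs <;> ring

theorem continuousOn_recursionTerm {b p q : ℝ} {g : ℕ → ℝ → ℝ} {S : Set ℝ}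
    (hg : ∀ n, ContinuousOn (g n) S) (n : ℕ) : ContinuousOn (recursionTerm b p q g n) S := by
  unfold recursionTerm
  exact continuousOn_const.add (continuousOn_const.mul
    (continuousOn_finsetSum _ fun k _ => (hg k).mul (hg (n - k))))

/-- Solution of the linear equation for the `n`-th probability by an integrating factor. -/
theorem eq_integral_recursionTerm {b p q : ℝ} (hp : 0 < p) (hq : 0 < q)
    {g : ℕ → ℝ → ℝ}
    (hmeas : ∀ n, Measurable (g n)) {M : ℝ} (hbd : ∀ n s, |riccatiCoeff b p q (g · s) n| ≤ M)
    (hg : ∀ n t, 0 ≤ t →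
      g n t = (if n = 0 then 1 else 0) + ∫ s in (0 : ℝ)..t, riccatiCoeff b p q (g · s) n)
    (hg0 : ∀ t, 0 ≤ t → g 0 t = 1 / (q + p * Real.exp (b * t))) {n : ℕ} (hn : 1 ≤ n)
    {t : ℝ} (ht : 0 ≤ t) :
    IntervalIntegrable (fun s => (q + p * Real.exp (b * s)) ^ 2 * Real.exp (-(b * s)) *
        recursionTerm b p q g n s) volume 0 t ∧
      g n t = Real.exp (b * t) / (q + p * Real.exp (b * t)) ^ 2 *
        ∫ s in (0 : ℝ)..t, (q + p * Real.exp (b * s)) ^ 2 * Real.exp (-(b * s)) *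
          recursionTerm b p q g n s := by
  have hcmeas : ∀ n, Measurable fun s => riccatiCoeff b p q (g · s) n := fun n => by
    unfold riccatiCoeff
    fun_prop
  have hcint : ∀ n u w, IntervalIntegrable (fun s => riccatiCoeff b p q (g · s) n) volume u w :=
    fun n u w => (intervalIntegrable_const (c := M)).mono_fun (hcmeas n).aestronglyMeasurable
      (Eventually.of_forall fun s => (hbd n s).trans (le_abs_self M))
  -- Bootstrap: the integral equation gives continuity, which makes the integrand continuous and so
  -- `g n` differentiable at positive times.
  have hgc : ∀ n, ContinuousOn (g n) (Ici 0) := fun n =>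
    ((continuous_const.add (intervalIntegral.continuous_primitive (hcint n) 0)).continuousOn).congr
      fun s hs => hg n s hs
  have hderiv : ∀ n, ∀ s, 0 < s → HasDerivAt (g n) (riccatiCoeff b p q (g · s) n) s := by
    intro n s hs
    have hca : ContinuousAt (fun s => riccatiCoeff b p q (g · s) n) s := by
      have : ∀ k, ContinuousAt (g k) s := fun k => (hgc k).continuousAt (Ici_mem_nhds hs)
      unfold riccatiCoeff
      fun_prop
    refine ((intervalIntegral.integral_hasDerivAt_right (hcint n 0 s)
      (hcmeas n).stronglyMeasurable.stronglyMeasurableAtFilter hca).const_add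
        (if n = 0 then 1 else 0)).congr_of_eventuallyEq ?_
    filter_upwards [Ici_mem_nhds hs] with u hu using hg n u hu
  -- The integrating factor: `m' = b (1 - 2 q g 0) m` with `g 0 = 1 / (q + p e^(b s))`.
  set m : ℝ → ℝ := fun s => (q + p * Real.exp (b * s)) ^ 2 * Real.exp (-(b * s)) with hm
  have hmc : Continuous m := by fun_prop
  have hsub : Icc 0 t ⊆ Ici 0 := fun s hs => hs.1
  have hint : IntervalIntegrable (fun s => m s * recursionTerm b p q g n s) volume 0 t := by
    refine ContinuousOn.intervalIntegrable ?_
    rw [uIcc_of_le ht]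
    exact hmc.continuousOn.mul ((continuousOn_recursionTerm hgc n).mono hsub)
  refine ⟨hint, ?_⟩
  have hFTC := intervalIntegral.integral_eq_sub_of_hasDerivAt_of_le ht
    (f := fun s => m s * g n s) (f' := fun s => m s * recursionTerm b p q g n s)
    (hmc.continuousOn.mul ((hgc n).mono hsub)) (fun s hs => ?_) hint
  · have hgn0 : g n 0 = 0 := by
      rw [hg n 0 le_rfl, intervalIntegral.integral_same, if_neg (by omega), add_zero]
    rw [hFTC, hgn0, hm]
    simp only [Real.exp_neg]
    have hE := Real.exp_pos (b * t)
    field_simp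
    ring
  · have hexp : HasDerivAt (fun s => Real.exp (b * s)) (Real.exp (b * s) * b) s := by
      simpa using ((hasDerivAt_id s).const_mul b).exp
    have hexpn : HasDerivAt (fun s => Real.exp (-(b * s))) (Real.exp (-(b * s)) * -b) s := by
      simpa using ((hasDerivAt_id s).const_mul b).neg.exp
    have hmd := ((((hexp.const_mul p).const_add q).pow 2).mul hexpn).mul (hderiv n s hs.1)
    refine hmd.congr_deriv ?_
    rw [riccatiCoeff_eq hn, hg0 s hs.1.le]
    simp only [hm, Pi.mul_apply, Pi.pow_apply, Real.exp_neg]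
    have hE := Real.exp_pos (b * s)
    field_simp
    ring

end Coefficients
-- The theorem.
theorem theorem3p4 {Ω : Type*} [MeasurableSpace Ω] (μ : Measure Ω) [IsProbabilityMeasure μ]
    (b p q : ℝ) (hb : 0 < b) (hp0 : 0 < p) (hp1 : p < 1) (hpq : p + q = 1)
    (X : ℝ → Ω → ℕ) (hX : IsMarkovBranchingProcess μ (birthDeathRates b p q) X)
    (hX0 : ∀ᵐ ω ∂μ, X 0 ω = 1) :
    -- the death number is almost surely finite, and it is a random variable
    (∀ t, 0 ≤ t → (∀ᵐ ω ∂μ, (deathTimes (fun s => X s ω) t).Finite) ∧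
      AEMeasurable (deathNumber X t) μ) ∧
    -- its generating function is the unique solution of the Riccati equation started at `1`
    (∀ v ∈ Icc (0 : ℝ) 1, ∀ y : ℝ → ℝ,
      (y 0 = 1 ∧ ∀ t, 0 ≤ t →
        HasDerivWithinAt y (b * (p * v - y t + q * y t ^ 2)) (Ici 0) t) ↔
      ∀ t, 0 ≤ t → y t = deathPGF μ X t v) ∧
    -- the closed form, wherever the right-hand side is defined
    (∀ t, 0 ≤ t → ∀ v ∈ Icc (0 : ℝ) 1, (v < 1 ∨ p < q) →
      deathPGF μ X t v = rootBeta p q v + (rootAlpha p q v - rootBeta p q v) /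
        (1 + (rootAlpha p q v - 1) / (1 - rootBeta p q v) *
          Real.exp ((rootAlpha p q v - rootBeta p q v) * b * q * t))) ∧
    -- the probabilities
    (∀ t, 0 ≤ t → deathProb μ X 0 t = 1 / (q + p * Real.exp (b * t))) ∧
    (∀ n, 1 ≤ n → ∀ t, 0 ≤ t →
      IntervalIntegrable (fun s => (q + p * Real.exp (b * s)) ^ 2 * Real.exp (-(b * s)) *
        recursionTerm b p q (deathProb μ X) n s) volume 0 t ∧
      deathProb μ X n t = Real.exp (b * t) / (q + p * Real.exp (b * t)) ^ 2 *
        ∫ s in (0 : ℝ)..t, (q + p * Real.exp (b * s)) ^ 2 * Real.exp (-(b * s)) *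
          recursionTerm b p q (deathProb μ X) n s) := by
  have hq : 0 < q := by linarith
  obtain ⟨⟨P, hP, hQ, hM⟩, hpath⟩ := id hX
  have hmeas : ∀ t, 0 ≤ t → AEMeasurable (deathNumber X t) μ := fun t ht =>
    hM.aemeasurable_deathNumber hpath ht
  have hmeas' := aemeasurable_deathNumber_of_nonneg hmeas
  have hric : ∀ v ∈ Icc (0 : ℝ) 1, IsRiccatiSolution b p q v (fun t => deathPGF μ X t v) := by
    intro v hv
    obtain ⟨y, hy, hy01⟩ := exists_isRiccatiSolution hb hp0 hq hpq hv
    exact hy.congr fun t ht => deathPGF_eq_of_isRiccatiSolution hpq hX hX0 hv hy hy01 ht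
  have hclosed : ∀ t, 0 ≤ t → ∀ v ∈ Icc (0 : ℝ) 1, (v < 1 ∨ p < q) →
      deathPGF μ X t v = riccatiClosedForm b p q v t := by
    intro t ht v hv hor
    rcases hv.2.lt_or_eq with hv1 | rfl
    · exact (hric v hv).unique (isRiccatiSolution_closedForm hp0 hq hpq hv.1 hv1) ht
    · rw [deathPGF_one, riccatiClosedForm_one hq hpq (hor.resolve_left (lt_irrefl _))]
  have hg0 : ∀ t, 0 ≤ t → deathProb μ X 0 t = 1 / (q + p * Real.exp (b * t)) := by
    intro t ht
    have h0 : (0 : ℝ) ∈ Icc (0 : ℝ) 1 := ⟨le_rfl, zero_le_one⟩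
    rw [← riccatiClosedForm_zero hp0 hq hpq, ← hclosed t ht 0 h0 (Or.inl one_pos),
      -- At `v = 0` only the term `n = 0` survives, since `0 ^ 0 = 1`.
      ← (hasSum_deathProb_mul_pow (hmeas' t) h0).tsum_eq, tsum_eq_single 0]
    · simp
    · intro n hn
      simp [hn]
  have hnonneg : ∀ n s, 0 ≤ deathProb μ X n s := fun n s => measureReal_nonneg
  refine ⟨fun t ht => ⟨?_, hmeas t ht⟩, fun v hv y => ⟨fun hy t ht => ?_, fun hy => ?_⟩,
    hclosed, hg0, fun n hn t ht => ?_⟩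
  · filter_upwards [hpath] with ω hω using (hω.deathTimes_eq_sampled ht).1
  · exact IsRiccatiSolution.unique hy (hric v hv) ht
  · exact (hric v hv).congr hy
  · have hprob := measurable_deathProb hmeas' hpath
    exact eq_integral_recursionTerm hp0 hq hprob
      (fun n s => abs_riccatiCoeff_le hb.le hp0.le hq.le (fun k => hnonneg k s)
        (hasSum_deathProb (hmeas' s)) n)
      (fun n t ht => eq_add_integral_riccatiCoeff hb.le hp0.le hq.le hnonneg
        (fun s => hasSum_deathProb (hmeas' s)) hprob
        (fun s v hv => hasSum_deathProb_mul_pow (hmeas' s) hv) hric ht n) hg0 hn ht
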